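/- There exist absolute constants $\bar\ell_1,\bar\ell_2,c>0$ such that the following holds. For all real $\Delta,\ell,L_2,\mu,\epsilon>0$ with $\kappa_y:=\ell/\mu\ge 1$ and $$\epsilon\le\min\left\{\frac14\left(\frac{\ell}{\bar\ell_1}\right)^{2}\left(\frac{L_2}{\bar\ell_2}\right)^{-1},\ \frac14\,\Delta^{7/10}\left(\frac{\ell}{\bar\ell_1}\right)^{-1/10}\left(\frac{L_2}{\bar\ell_2}\right)^{2/5}\right\},$$ there are integers $n,n'\ge 1$ and a function $f:\mathbb{R}^{n}\times\mathbb{R}^{n'}\to\mathbb{R}$ (a nonconvex-strongly-concave problem $\min_{x}\max_{y}f(x,y)$) with the following properties. (i) $f$ is $\ell$-smooth (differentiable, with $\nabla f$ $\ell$-Lipschitz in $(x,y)$ for the Euclidean norm), and $f(x,\cdot)$ is $\mu$-strongly concave for every $x\in\mathbb{R}^n$. (ii) The function $\Phi(x):=\max_{y}f(x,y)$ is well defined and twice differentiable on $\mathbb{R}^n$, its Hessian is $L_2$-Lipschitz in the operator norm, $\Phi$ attains its minimum, and $\Phi(0)-\min_x\Phi(x)\le\Delta$. (iii) Every first-order (span-based)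 algorithm needs at least $c\,\Delta\sqrt{\kappa_y}\,\ell^{3/7}L_2^{2/7}\epsilon^{-12/7}$ gradient evaluations to find a point $\bar x$ with $\|\nabla\Phi(\bar x)\|\le\epsilon$. That is, let $(x_t,y_t)_{t\ge0}$ be any sequence in $\mathbb{R}^n\times\mathbb{R}^{n'}$ with $(x_0,y_0)=(0,0)$ and, for every $t\ge0$, $$\operatorname{supp}(x_{t+1},y_{t+1})\subseteq\bigcup_{0\le i\le t}\Big(\operatorname{supp}(x_i,y_i)\cup\operatorname{supp}\big(\nabla f(x_i,y_i)\big)\Big),$$ where $\operatorname{supp}$ denotes the set of indices of nonzero coordinates. If $\|\nabla\Phi(x_t)\|\le\epsilon$ for some $t\geq 0$ (so that $x_t$ is found after the $t$ gradient evaluations at $(x_0,y_0),\dots,(x_{t-1},y_{t-1})$), then $$t\ \ge\ c\,\Delta\sqrt{\kappa_y}\,\ell^{3/7}L_2^{2/7}\epsilon^{-12/7}.$$ -/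

import Mathlib

/-- The joint space of the variables `(x, y)`, with `x ∈ ℝⁿ`, `y ∈ ℝᵐ`, carrying the Euclidean
norm of `ℝⁿ⁺ᵐ`. -/
abbrev JointSpace (n m : ℕ) : Type :=
  WithLp 2 (EuclideanSpace ℝ (Fin n) × EuclideanSpace ℝ (Fin m))

/-- The point `(x, y)` of the joint space. -/
abbrev joint {n m : ℕ} (x : EuclideanSpace ℝ (Fin n)) (y : EuclideanSpace ℝ (Fin m)) :
    JointSpace n m :=
  WithLp.toLp 2 (x, y)

/-- `g` is `L`-smooth: it is differentiable and its gradient is `L`-Lipschitz. -/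
def IsSmoothWith {E : Type*} [NormedAddCommGroup E] [InnerProductSpace ℝ E] [CompleteSpace E]
    (L : ℝ) (g : E → ℝ) : Prop :=
  Differentiable ℝ g ∧ ∀ u v : E, ‖gradient g u - gradient g v‖ ≤ L * ‖u - v‖

/-- The Hessian of `g`, i.e. the derivative of its gradient, is defined everywhere and is
`L`-Lipschitz in the operator norm. -/
def HasLipschitzHessian {E : Type*} [NormedAddCommGroup E] [InnerProductSpace ℝ E]
    [CompleteSpace E] (L : ℝ) (g : E → ℝ) : Prop :=
  Differentiable ℝ g ∧ Differentiable ℝ (gradient g) ∧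
    ∀ u v : E, ‖fderiv ℝ (gradient g) u - fderiv ℝ (gradient g) v‖ ≤ L * ‖u - v‖

/-- `f(x, ·)` is `μ`-strongly concave for every fixed `x`. -/
def IsStronglyConcaveInY {n m : ℕ} (μ : ℝ) (f : JointSpace n m → ℝ) : Prop :=
  ∀ x : EuclideanSpace ℝ (Fin n), StrongConcaveOn Set.univ μ fun y => f (joint x y)

/-- `Φ(x) = max_y f(x, y)` for every `x`, the maximum being attained. -/
def IsPrimalFunction {n m : ℕ} (f : JointSpace n m → ℝ) (Φ : EuclideanSpace ℝ (Fin n) → ℝ) :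
    Prop :=
  ∀ x, IsGreatest (Set.range fun y : EuclideanSpace ℝ (Fin m) => f (joint x y)) (Φ x)

/-- The support of `z = (x, y)`: the set of coordinates of `x` and of `y` that are nonzero. -/
def coordSupport {n m : ℕ} (z : JointSpace n m) : Set (Fin n ⊕ Fin m) :=
  {k | Sum.elim (fun i => z.fst i) (fun j => z.snd j) k ≠ 0}

/-- `z 0, z 1, z 2, …` is a sequence of queries that a first-order (span-based) algorithm started
at the origin can make on `f`: the support of each iterate lies in the union of the supports of the
previous queries and of the gradients of `f` at these. -/
def IsFirstOrderSequence {n m : ℕ} (f : JointSpace n m → ℝ) (z : ℕ → JointSpace n m) : Prop :=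
  z 0 = 0 ∧ ∀ t : ℕ,
    coordSupport (z (t + 1)) ⊆
      ⋃ i ∈ Set.Iic t, (coordSupport (z i) ∪ coordSupport (gradient f (z i)))

/-! The function Φ is `hardPrimal`: N nodes joined by springs of stiffness lam, the first node
pulled towards σ by a weaker spring of stiffness lam * r, and a potential lam * σ² * r² * bend (x /
σ) at every node. The potential is minimal at σ and has a degenerate critical point at 0. Divided by
lam * σ, the gradient is the force in a discrete Newton equation: the downward slope between
neighbouring nodes changes by the gradient entry minus r² * `bendDeriv`. Since `bendDeriv` ≤ 0 on
(-∞, 1], the potential only steepens a descending chain. The last node is a free end, where the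
slope must vanish. If the last coordinate is 0, the chain has descended from the boundary pull, so
its slope reached order r, and only a gradient of squared norm of order r³ can stop it
(`chain_force_lower_bound`, `lt_norm_gradient_hardPrimal`).

To gain the factor √κ, f is Φ minus a sum of squares in y that can be made zero for every x, so max
over y returns Φ. The squares are chosen so that the products of neighbouring x-coordinates cancel:
in f, adjacent nodes communicate only through a path of n + 1 coordinates of y
(`chainFun_block_eq`). Strong concavity with modulus μ permits n of order √(lam / μ)
(`exists_coupled_instance`). Each gradient reveals at most one further coordinate of the whole chain
(`coordSeq_eq_zero_of_isFirstOrderSequence`), so the last node remains 0 for (N - 1) * (n + 2)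
evaluations.

With r = θ², the smoothness constants and ε determine σ and θ, the gap Δ determines N of order Δ /
(lam * σ² * r²), and the product of N with the path length is the claimed rate (`rate_eq`). -/

/-! ### The scalar potential and its derivative bounds. -/

/-- The scalar nonconvex term of the hard instance. -/
noncomputable def bend (x : ℝ) : ℝ := x ^ 2 / 2 - x - Real.log (1 + x ^ 2) / 2 + Real.arctan x

/-- The derivative of `bend`. -/
noncomputable def bendDeriv (x : ℝ) : ℝ := x ^ 2 * (x - 1) / (1 + x ^ 2)

/-- The second derivative of `bend`. -/
noncomputable def bendDeriv₂ (x : ℝ) : ℝ :=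
  1 + 1 / (1 + x ^ 2) - 2 * (1 / (1 + x ^ 2)) ^ 2 - 2 * (1 / (1 + x ^ 2)) * (x / (1 + x ^ 2))

theorem hasDerivAt_bend (x : ℝ) : HasDerivAt bend (bendDeriv x) x := by
  have hpos : (1 + x ^ 2) ≠ 0 := by positivity
  have h1 : HasDerivAt (fun x : ℝ => x ^ 2) (2 * x) x := by simpa using hasDerivAt_pow 2 x
  have h2 := (h1.const_add 1).log hpos
  have h := (((h1.div_const 2).sub (hasDerivAt_id x)).sub (h2.div_const 2)).add
    (Real.hasDerivAt_arctan x)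
  refine h.congr_deriv ?_
  unfold bendDeriv
  field_simp
  ring

theorem hasDerivAt_bendDeriv (x : ℝ) : HasDerivAt bendDeriv (bendDeriv₂ x) x := by
  have hpos : (1 + x ^ 2) ≠ 0 := by positivity
  have h1 : HasDerivAt (fun x : ℝ => x ^ 2) (2 * x) x := by simpa using hasDerivAt_pow 2 x
  have h := (h1.mul ((hasDerivAt_id x).sub_const 1)).div (h1.const_add 1) hpos
  refine h.congr_deriv ?_
  unfold bendDeriv₂
  simp only [id, Pi.mul_apply]
  field_simp
  ring

theorem bendDeriv_zero : bendDeriv 0 = 0 := by simp [bendDeriv]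

theorem inv_one_add_sq_mem (x : ℝ) : 0 ≤ 1 / (1 + x ^ 2) ∧ 1 / (1 + x ^ 2) ≤ 1 := by
  constructor
  · positivity
  · rw [div_le_one (by positivity)]; nlinarith [sq_nonneg x]

theorem abs_div_one_add_sq_le (x : ℝ) : |x / (1 + x ^ 2)| ≤ 1 / 2 := by
  rw [abs_le, le_div_iff₀ (by positivity), div_le_iff₀ (by positivity)]
  constructor <;> nlinarith [sq_nonneg (x - 1), sq_nonneg (x + 1)]

theorem abs_bendDeriv₂_le (x : ℝ) : |bendDeriv₂ x| ≤ 6 := by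
  obtain ⟨h0, h1⟩ := inv_one_add_sq_mem x
  have h2 := abs_le.1 (abs_div_one_add_sq_le x)
  unfold bendDeriv₂
  generalize 1 / (1 + x ^ 2) = u at *
  generalize x / (1 + x ^ 2) = v at *
  rw [abs_le]
  constructor <;> nlinarith [mul_nonneg h0 (sub_nonneg.2 h1), mul_nonneg h0 (sub_nonneg.2 h2.1),
    mul_nonneg h0 (sub_nonneg.2 h2.2)]

theorem abs_inv_one_add_sq_sub_le (a b : ℝ) :
    |1 / (1 + a ^ 2) - 1 / (1 + b ^ 2)| ≤ |a - b| := by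
  have e : 1 / (1 + a ^ 2) - 1 / (1 + b ^ 2) =
      -((a / (1 + a ^ 2)) * (1 / (1 + b ^ 2)) + (b / (1 + b ^ 2)) * (1 / (1 + a ^ 2))) * (a - b) := by
    field_simp
    ring
  rw [e, abs_mul, abs_neg]
  refine mul_le_of_le_one_left (abs_nonneg _) ((abs_add_le _ _).trans ?_)
  rw [abs_mul, abs_mul, abs_of_nonneg (inv_one_add_sq_mem a).1,
    abs_of_nonneg (inv_one_add_sq_mem b).1]
  nlinarith [abs_div_one_add_sq_le a, abs_div_one_add_sq_le b, inv_one_add_sq_mem a,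
    inv_one_add_sq_mem b, abs_nonneg (a / (1 + a ^ 2)), abs_nonneg (b / (1 + b ^ 2))]

theorem abs_div_one_add_sq_sub_le (a b : ℝ) :
    |a / (1 + a ^ 2) - b / (1 + b ^ 2)| ≤ |a - b| := by
  have e : a / (1 + a ^ 2) - b / (1 + b ^ 2) =
      ((1 - a * b) / ((1 + a ^ 2) * (1 + b ^ 2))) * (a - b) := by
    field_simp
    ring
  rw [e, abs_mul]
  refine mul_le_of_le_one_left (abs_nonneg _) ?_
  rw [abs_le, le_div_iff₀ (by positivity), div_le_iff₀ (by positivity)]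
  constructor <;> nlinarith [sq_nonneg (a - b), sq_nonneg (a + b), sq_nonneg (a * b), sq_nonneg a,
    sq_nonneg b]

theorem abs_mul_sub_mul_le {a b c d C : ℝ} (ha : |a| ≤ 1) (hd : |d| ≤ 1) (hac : |a - c| ≤ C)
    (hbd : |b - d| ≤ C) : |a * b - c * d| ≤ 2 * C := by
  have e : a * b - c * d = a * (b - d) + (a - c) * d := by ring
  rw [e]
  refine (abs_add_le _ _).trans ?_
  rw [abs_mul, abs_mul]
  nlinarith [abs_nonneg a, abs_nonneg d, abs_nonneg (b - d), abs_nonneg (a - c)]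

theorem abs_bendDeriv₂_sub_le (a b : ℝ) : |bendDeriv₂ a - bendDeriv₂ b| ≤ 9 * |a - b| := by
  have hu := abs_inv_one_add_sq_sub_le a b
  have hv := abs_div_one_add_sq_sub_le a b
  have hua : |1 / (1 + a ^ 2)| ≤ 1 := by
    rw [abs_of_nonneg (inv_one_add_sq_mem a).1]; exact (inv_one_add_sq_mem a).2
  have hub : |1 / (1 + b ^ 2)| ≤ 1 := by
    rw [abs_of_nonneg (inv_one_add_sq_mem b).1]; exact (inv_one_add_sq_mem b).2
  have hvb : |b / (1 + b ^ 2)| ≤ 1 := (abs_div_one_add_sq_le b).trans (by norm_num)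
  have h1 := abs_le.1 (abs_mul_sub_mul_le hua hub hu hu)
  have h2 := abs_le.1 (abs_mul_sub_mul_le hua hvb hu hv)
  have h3 := abs_le.1 hu
  unfold bendDeriv₂
  rw [abs_le]
  constructor <;> nlinarith

theorem bend_one_le (x : ℝ) : bend 1 ≤ bend x := by
  have hd : Differentiable ℝ bend := fun x => (hasDerivAt_bend x).differentiableAt
  have hder : deriv bend = bendDeriv := funext fun x => (hasDerivAt_bend x).deriv
  rcases le_total 1 x with h | h
  · refine monotoneOn_of_deriv_nonneg (convex_Ici 1) hd.continuous.continuousOn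
      hd.differentiableOn (fun y hy => ?_) (Set.mem_Ici.2 le_rfl) (Set.mem_Ici.2 h) h
    rw [interior_Ici, Set.mem_Ioi] at hy
    rw [hder]
    have : 0 ≤ y - 1 := by linarith
    unfold bendDeriv
    positivity
  · refine antitoneOn_of_deriv_nonpos (convex_Iic 1) hd.continuous.continuousOn
      hd.differentiableOn (fun y hy => ?_) (Set.mem_Iic.2 h) (Set.mem_Iic.2 le_rfl) h
    rw [interior_Iic, Set.mem_Iio] at hy
    rw [hder]
    unfold bendDeriv
    exact div_nonpos_of_nonpos_of_nonneg
      (mul_nonpos_of_nonneg_of_nonpos (sq_nonneg y) (by linarith)) (by positivity)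

theorem bend_zero_sub_bend_one_le : bend 0 - bend 1 ≤ 1 := by
  have h2 : Real.log 2 ≤ 1 := by
    have := Real.log_le_sub_one_of_pos (show (0 : ℝ) < 2 by norm_num)
    linarith
  have h3 := Real.pi_pos
  unfold bend
  norm_num
  linarith

theorem bendDeriv_nonpos {x : ℝ} (hx : x ≤ 1) : bendDeriv x ≤ 0 :=
  div_nonpos_of_nonpos_of_nonneg
      (mul_nonpos_of_nonneg_of_nonpos (sq_nonneg x) (by linarith)) (by positivity)

theorem bendDeriv_le_of_mem {x : ℝ} (h1 : 1 / 4 ≤ x) (h2 : x ≤ 3 / 4) :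
    bendDeriv x ≤ -(1 / 100) := by
  unfold bendDeriv
  rw [div_le_iff₀ (by positivity)]
  have h := mul_nonneg (sub_nonneg.2 h1) (sub_nonneg.2 h2)
  nlinarith [h, mul_nonneg h (by linarith : 0 ≤ x)]

theorem bendDeriv_le_of_le {x : ℝ} (h1 : x ≤ -1) : bendDeriv x ≤ -(1 / 100) := by
  unfold bendDeriv
  rw [div_le_iff₀ (by positivity)]
  nlinarith [mul_nonneg (sub_nonneg.2 h1) (sq_nonneg x)]

/-! ### Discrete dynamics of the slopes. -/

/-- Young's inequality: it trades a force of unknown sign for a fixed loss per step and a share of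
the total squared force. -/
theorem neg_sq_div_sub_le {g η : ℝ} (hη : 0 < η) : -(η / 2) - g ^ 2 / (2 * η) ≤ g := by
  have e : g + η / 2 + g ^ 2 / (2 * η) = (g + η) ^ 2 / (2 * η) := by field_simp; ring
  have : 0 ≤ (g + η) ^ 2 / (2 * η) := by positivity
  linarith

/-- If the downward slopes `s i = Y i - Y (i + 1)` of a sequence `Y` obey the discrete equation of
motion with a small force `g`, then a slope that is not small in the region `Y ≤ 3 / 4` never
becomes small again. -/
theorem slope_persists {N j : ℕ} {r : ℝ} {Y s g : ℕ → ℝ} (hr : 0 < r) (hr1 : r ≤ 1)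
    (hs : ∀ i < N, s i = Y i - Y (i + 1))
    (hstep : ∀ i < N, s (i + 1) = s i + g i - r ^ 2 * bendDeriv (Y (i + 1)))
    (hg : ∑ i ∈ Finset.range N, g i ^ 2 ≤ (1 / 10000) ^ 2 * r ^ 3)
    (hj : j < N) (hYj : Y (j + 1) ≤ 3 / 4) (hsj : r / 50 ≤ s j) : r / 100 ≤ s N := by
  set E : ℕ → ℝ := fun i => ∑ k ∈ Finset.range i, g k ^ 2 with hE
  have hEmono : ∀ i ≤ N, E i ≤ (1 / 10000) ^ 2 * r ^ 3 := fun i hi =>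
    (Finset.sum_le_sum_of_subset_of_nonneg (Finset.range_mono hi)
      fun _ _ _ => sq_nonneg _).trans hg
  have hEj : 0 ≤ E j := Finset.sum_nonneg fun _ _ => sq_nonneg _
  have hEsucc : ∀ i, E (i + 1) = E i + g i ^ 2 := fun i => Finset.sum_range_succ _ _
  -- With this η the whole force budget costs at most r / 2000 of slope, and the loss η / 2 per step
  -- equals (r / 2000) * (r / 100), the toll on a step of length r / 100.
  set η : ℝ := r ^ 2 / 100000 with hη
  have hη0 : 0 < η := by positivity
  have hηr : η ≤ r / 100000 := by rw [hη]; gcongr; nlinarith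
  have hEη : ∀ x ≤ (1 / 10000) ^ 2 * r ^ 3, x / (2 * η) ≤ r / 2000 := fun x hx => by
    rw [div_le_iff₀ (by positivity), hη]; nlinarith
  -- The loss per step is charged to the distance descended while Y stays above -1, a total of at
  -- most 7 / 4; below -1 the potential's push, at least r² / 100, pays for it. Truncating at -1
  -- unites both regimes, so the bound does not depend on N.
  have hYi : ∀ i, j + 1 ≤ i → i ≤ N →
      Y i ≤ 3 / 4 ∧ s i ≥ r / 50 - η - (r / 2000) * (max (Y (j + 1)) (-1) - max (Y i) (-1))
        - (E i - E j) / (2 * η) := by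
    intro i hi
    induction i, hi using Nat.le_induction with
    | base =>
      intro hN
      refine ⟨hYj, ?_⟩
      have h1 := bendDeriv_nonpos (hYj.trans (by norm_num))
      have h2 := neg_sq_div_sub_le (g := g j) hη0
      rw [hstep j hj, hEsucc]
      have h3 : r ^ 2 * bendDeriv (Y (j + 1)) ≤ 0 :=
        mul_nonpos_of_nonneg_of_nonpos (by positivity) h1
      have h4 : (E j + g j ^ 2 - E j) / (2 * η) = g j ^ 2 / (2 * η) := by ring_nf
      rw [h4, sub_self, mul_zero]
      linarith
    | succ i hi ih =>
      intro hN
      obtain ⟨hY, hsi⟩ := ih (by omega)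
      have hsi' : r / 100 ≤ s i := by
        have h1 := hEη (E i - E j) (by linarith [hEmono i (by omega)])
        have h2 : max (Y (j + 1)) (-1) ≤ 3 / 4 := max_le hYj (by norm_num)
        have h3 : -1 ≤ max (Y i) (-1) := le_max_right _ _
        have h4 : (r / 2000) * (max (Y (j + 1)) (-1) - max (Y i) (-1)) ≤ (r / 2000) * (7 / 4) := by
          gcongr; linarith
        linarith
      have hsY := hs i (by omega)
      have hY' : Y (i + 1) ≤ 3 / 4 := by linarith
      refine ⟨hY', ?_⟩
      rw [hstep i (by omega), hEsucc]
      have h2 := neg_sq_div_sub_le (g := g i) hη0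
      have h4 : (E i + g i ^ 2 - E j) / (2 * η) = (E i - E j) / (2 * η) + g i ^ 2 / (2 * η) := by
        ring
      rw [h4]
      suffices h : η / 2 ≤ (r / 2000) * (max (Y i) (-1) - max (Y (i + 1)) (-1))
          - r ^ 2 * bendDeriv (Y (i + 1)) by linarith
      rcases le_or_gt (Y (i + 1)) (-1) with hc | hc
      · have h5 : max (Y (i + 1)) (-1) ≤ max (Y i) (-1) := max_le_max (by linarith) le_rfl
        have h6 := mul_nonneg (show 0 ≤ r / 2000 by positivity) (sub_nonneg.2 h5)
        have h7 := mul_le_mul_of_nonneg_left (bendDeriv_le_of_le hc) (sq_nonneg r)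
        rw [hη]
        nlinarith
      · have h1 := bendDeriv_nonpos (hY'.trans (by norm_num))
        have h3 : r ^ 2 * bendDeriv (Y (i + 1)) ≤ 0 :=
          mul_nonpos_of_nonneg_of_nonpos (by positivity) h1
        have h5 : max (Y i) (-1) - max (Y (i + 1)) (-1) = s i := by
          rw [max_eq_left hc.le, max_eq_left (by linarith), hsY]
        rw [h5]
        have h6 : (r / 2000) * (r / 100) ≤ (r / 2000) * s i := by gcongr
        rw [hη]
        nlinarith
  obtain ⟨-, h⟩ := hYi N (by omega) le_rfl
  have h1 := hEη (E N - E j) (by linarith [hEmono N le_rfl])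
  have h2 : max (Y (j + 1)) (-1) ≤ 3 / 4 := max_le hYj (by norm_num)
  have h3 : -1 ≤ max (Y N) (-1) := le_max_right _ _
  have h4 : (r / 2000) * (max (Y (j + 1)) (-1) - max (Y N) (-1)) ≤ (r / 2000) * (7 / 4) := by
    gcongr; linarith
  linarith

/-- A sequence that descends from above `3 / 4` to below `1 / 4` under a small force has a slope
that is not small on the way. -/
theorem exists_slope_ge {N : ℕ} {r : ℝ} {Y s g : ℕ → ℝ} (hr : 0 < r) (hr1 : r ≤ 1)
    (hs : ∀ i < N, s i = Y i - Y (i + 1))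
    (hstep : ∀ i < N, s (i + 1) = s i + g i - r ^ 2 * bendDeriv (Y (i + 1)))
    (hg : ∑ i ∈ Finset.range N, g i ^ 2 ≤ (1 / 10000) ^ 2 * r ^ 3)
    (hN : 1 ≤ N) (h1 : 3 / 4 < Y 1) (hYN : Y N < 1 / 4) :
    ∃ j < N, Y (j + 1) ≤ 3 / 4 ∧ r / 50 ≤ s j := by
  by_contra! hcon
  -- the last index `p` with `Y p > 3 / 4`
  obtain ⟨p, hpN, hp, hpmax⟩ : ∃ p ≤ N, 3 / 4 < Y p ∧ ∀ i, p < i → i ≤ N → Y i ≤ 3 / 4 := by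
    classical
    refine ⟨Nat.findGreatest (fun i => 3 / 4 < Y i) N, Nat.findGreatest_le N,
      Nat.findGreatest_spec (P := fun i => 3 / 4 < Y i) hN h1, fun i hi hiN => ?_⟩
    exact not_lt.1 (Nat.findGreatest_is_greatest hi hiN)
  have hpN' : p < N := lt_of_le_of_ne hpN fun h => by rw [h] at hp; linarith
  -- the first index `q` beyond `p` with `Y q < 1 / 4`
  obtain ⟨q, hpq, hqN, hq, hqmin⟩ : ∃ q, p < q ∧ q ≤ N ∧ Y q < 1 / 4 ∧
      ∀ i, p < i → i < q → 1 / 4 ≤ Y i := by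
    classical
    have hex : ∃ q, p < q ∧ Y q < 1 / 4 := ⟨N, hpN', hYN⟩
    refine ⟨Nat.find hex, (Nat.find_spec hex).1, Nat.find_min' hex ⟨hpN', hYN⟩,
      (Nat.find_spec hex).2, fun i hi hiq => ?_⟩
    have := Nat.find_min hex hiq
    push Not at this
    exact this hi
  set E : ℕ → ℝ := fun i => ∑ k ∈ Finset.range i, g k ^ 2 with hE
  have hEmono : ∀ i ≤ N, E i ≤ (1 / 10000) ^ 2 * r ^ 3 := fun i hi =>
    (Finset.sum_le_sum_of_subset_of_nonneg (Finset.range_mono hi)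
      fun _ _ _ => sq_nonneg _).trans hg
  have hEp : 0 ≤ E p := Finset.sum_nonneg fun _ _ => sq_nonneg _
  have hEsucc : ∀ i, E (i + 1) = E i + g i ^ 2 := fun i => Finset.sum_range_succ _ _
  set η : ℝ := r ^ 2 / 100000 with hη
  have hη0 : 0 < η := by positivity
  have hsp : 0 < s p := by
    rw [hs p hpN']; linarith [hpmax (p + 1) (by omega) (by omega)]
  -- Between 3 / 4 and 1 / 4 the potential adds at least r² / 100 to the slope per step, of which η
  -- / 2 is lost to Young's inequality; slopes below r / 50 make the crossing slow.
  have key : ∀ d, p + d + 1 ≤ q →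
      d * (r ^ 2 * (9 / 1000)) - (E (p + d) - E p) / (2 * η) ≤ s (p + d) ∧
      Y p - Y (p + d) ≤ d * (r / 50) := by
    intro d
    induction d with
    | zero => intro _; simp [hsp.le]
    | succ d ih =>
      intro hd
      obtain ⟨ih1, ih2⟩ := ih (by omega)
      have hm1 := hpmax (p + d + 1) (by omega) (by omega)
      have hm2 := hqmin (p + d + 1) (by omega) (by omega)
      have hb := mul_le_mul_of_nonneg_left (bendDeriv_le_of_mem hm2 hm1) (sq_nonneg r)
      have h2 := neg_sq_div_sub_le (g := g (p + d)) hη0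
      have hst := hstep (p + d) (by omega)
      have hsd := hs (p + d) (by omega)
      have hc := hcon (p + d) (by omega) hm1
      rw [← add_assoc, hEsucc, hst]
      have h4 : (E (p + d) + g (p + d) ^ 2 - E p) / (2 * η) =
          (E (p + d) - E p) / (2 * η) + g (p + d) ^ 2 / (2 * η) := by ring
      rw [h4]
      push_cast
      have hη2 : η / 2 ≤ r ^ 2 / 1000 := by rw [hη]; nlinarith [sq_nonneg r]
      constructor <;> nlinarith
  obtain ⟨d, rfl⟩ : ∃ d, q = p + d + 1 := ⟨q - p - 1, by omega⟩
  obtain ⟨k1, k2⟩ := key d le_rfl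
  have hc := hcon (p + d) (by omega) (hpmax _ (by omega) hqN)
  have hsd := hs (p + d) (by omega)
  have hEd : (E (p + d) - E p) / (2 * η) ≤ r / 2000 := by
    rw [div_le_iff₀ (by positivity), hη]
    nlinarith [hEmono (p + d) (by omega)]
  -- A drop of more than 1 / 2 in d + 1 steps of at most r / 50 forces (d + 1) * r ≥ 25, and r ≤ 1.
  -- The accumulated slope, at least 24 * (9 / 1000) * r - r / 2000, then exceeds r / 50.
  have hd : 24 ≤ (d : ℝ) * r := by nlinarith
  nlinarith

/-- The gradient lower bound for the nonconvex chain: under a small force the chain cannot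
descend from its boundary condition to `0`. -/
theorem chain_force_lower_bound {N : ℕ} {r : ℝ} {Y s g : ℕ → ℝ} (hr : 0 < r) (hr1 : r ≤ 1)
    (hN : 1 ≤ N) (h0 : s 0 = r * (1 - Y 1)) (hs : ∀ i < N, s i = Y i - Y (i + 1)) (hsN : s N = 0)
    (hstep : ∀ i < N, s (i + 1) = s i + g i - r ^ 2 * bendDeriv (Y (i + 1)))
    (hYN : Y N = 0) :
    (1 / 10000) ^ 2 * r ^ 3 < ∑ i ∈ Finset.range N, g i ^ 2 := by
  by_contra! hg
  obtain ⟨j, hj, hYj, hsj⟩ : ∃ j < N, Y (j + 1) ≤ 3 / 4 ∧ r / 50 ≤ s j := by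
    rcases le_or_gt (Y 1) (3 / 4) with h | h
    · exact ⟨0, by omega, h, by rw [h0]; nlinarith⟩
    · exact exists_slope_ge hr hr1 hs hstep hg hN h (by rw [hYN]; norm_num)
  have := slope_persists hr hr1 hs hstep hg hj hYj hsj
  rw [hsN] at this
  linarith

/-! ### Chain functions: gradient, smoothness, Hessian and spread of support. -/

/-- The coordinates of a vector as a sequence, extended by zero. -/
noncomputable def coordSeq {M : ℕ} (w : EuclideanSpace ℝ (Fin M)) (p : ℕ) : ℝ :=
  if hp : p < M then w ⟨p, hp⟩ else 0

theorem coordSeq_fin {M : ℕ} (w : EuclideanSpace ℝ (Fin M)) (p : Fin M) :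
    coordSeq w p = w p := by simp [coordSeq]

theorem coordSeq_of_le {M : ℕ} (w : EuclideanSpace ℝ (Fin M)) {p : ℕ} (hp : M ≤ p) :
    coordSeq w p = 0 := by simp [coordSeq, hp]

theorem coordSeq_add {M : ℕ} (v w : EuclideanSpace ℝ (Fin M)) (p : ℕ) :
    coordSeq (v + w) p = coordSeq v p + coordSeq w p := by
  unfold coordSeq; split_ifs <;> simp

theorem coordSeq_sub {M : ℕ} (v w : EuclideanSpace ℝ (Fin M)) (p : ℕ) :
    coordSeq (v - w) p = coordSeq v p - coordSeq w p := by
  unfold coordSeq; split_ifs <;> simp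

theorem coordSeq_smul {M : ℕ} (a : ℝ) (w : EuclideanSpace ℝ (Fin M)) (p : ℕ) :
    coordSeq (a • w) p = a * coordSeq w p := by
  unfold coordSeq; split_ifs <;> simp

theorem coordSeq_toLp {M : ℕ} (G : ℕ → ℝ) {p : ℕ} (hp : p < M) :
    coordSeq (WithLp.toLp 2 fun i : Fin M => G i) p = G p := by simp [coordSeq, hp]

theorem norm_sq_eq_sum_coordSeq {M : ℕ} (w : EuclideanSpace ℝ (Fin M)) :
    ‖w‖ ^ 2 = ∑ p ∈ Finset.range M, coordSeq w p ^ 2 := by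
  rw [EuclideanSpace.norm_sq_eq, Finset.sum_range]
  simp [coordSeq_fin]

theorem inner_eq_sum_coordSeq {M : ℕ} (v w : EuclideanSpace ℝ (Fin M)) :
    inner ℝ v w = ∑ p ∈ Finset.range M, coordSeq v p * coordSeq w p := by
  rw [PiLp.inner_apply, Finset.sum_range]
  simp [coordSeq_fin, mul_comm]

/-- The coordinate functional `w ↦ coordSeq w p`. -/
noncomputable def coordSeqL (M p : ℕ) : EuclideanSpace ℝ (Fin M) →L[ℝ] ℝ :=
  LinearMap.toContinuousLinearMap
    { toFun := fun w => coordSeq w p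
      map_add' := fun v w => coordSeq_add v w p
      map_smul' := fun a w => coordSeq_smul a w p }

@[simp] theorem coordSeqL_apply {M p : ℕ} (w : EuclideanSpace ℝ (Fin M)) :
    coordSeqL M p w = coordSeq w p := rfl

theorem hasFDerivAt_coordSeq {M : ℕ} (p : ℕ) (w : EuclideanSpace ℝ (Fin M)) :
    HasFDerivAt (fun w => coordSeq w p) (coordSeqL M p) w :=
  (coordSeqL M p).hasFDerivAt

/-- A chain function: a sum of functions of single coordinates and of products of neighbouring
coordinates. -/
noncomputable def chainFun (M : ℕ) (h : ℕ → ℝ → ℝ) (c : ℕ → ℝ) (w : EuclideanSpace ℝ (Fin M)) : ℝ :=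
  ∑ p ∈ Finset.range M,
    (h p (coordSeq w p) + c (p + 1) * (coordSeq w p * coordSeq w (p + 1)))

/-- The `p`-th partial derivative of a chain function. -/
noncomputable def chainPartial {M : ℕ} (h' : ℕ → ℝ → ℝ) (c : ℕ → ℝ) (w : EuclideanSpace ℝ (Fin M))
    (p : ℕ) : ℝ :=
  h' p (coordSeq w p) + c p * coordSeq w (p - 1) + c (p + 1) * coordSeq w (p + 1)

/-- The gradient of a chain function. -/
noncomputable def chainGrad (M : ℕ) (h' : ℕ → ℝ → ℝ) (c : ℕ → ℝ) (w : EuclideanSpace ℝ (Fin M)) :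
    EuclideanSpace ℝ (Fin M) :=
  WithLp.toLp 2 fun p => chainPartial h' c w p

theorem coordSeq_chainGrad {M : ℕ} (h' : ℕ → ℝ → ℝ) (c : ℕ → ℝ) (w : EuclideanSpace ℝ (Fin M))
    {p : ℕ} (hp : p < M) : coordSeq (chainGrad M h' c w) p = chainPartial h' c w p :=
  coordSeq_toLp (chainPartial h' c w) hp

theorem sum_range_shift_pred {M : ℕ} (F : ℕ → ℝ) (h0 : F 0 = 0) (hM : F M = 0) :
    ∑ p ∈ Finset.range M, F (p + 1) = ∑ p ∈ Finset.range M, F p := by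
  have h1 := Finset.sum_range_succ F M
  rw [Finset.sum_range_succ', h0, hM] at h1
  linarith

/-- Each product of neighbours contributes to two partial derivatives; an index shift collects them.
The hypothesis `c 0 = 0` neutralizes the truncated index `0 - 1 = 0`, and extension by zero handles
the other end. -/
theorem hasGradientAt_chainFun {M : ℕ} {h h' : ℕ → ℝ → ℝ} {c : ℕ → ℝ}
    (hh : ∀ p < M, ∀ x, HasDerivAt (h p) (h' p x) x) (hc : c 0 = 0)
    (w : EuclideanSpace ℝ (Fin M)) :
    HasGradientAt (chainFun M h c) (chainGrad M h' c w) w := by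
  rw [hasGradientAt_iff_hasFDerivAt]
  have hd : HasFDerivAt (chainFun M h c) (∑ p ∈ Finset.range M,
      (h' p (coordSeq w p) • coordSeqL M p + c (p + 1) • (coordSeq w p • coordSeqL M (p + 1) +
        coordSeq w (p + 1) • coordSeqL M p))) w := by
    unfold chainFun
    refine HasFDerivAt.fun_sum fun p hp => HasFDerivAt.add ?_ ?_
    · exact (hh p (Finset.mem_range.1 hp) _).comp_hasFDerivAt w (hasFDerivAt_coordSeq p w)
    · exact ((hasFDerivAt_coordSeq p w).mul (hasFDerivAt_coordSeq (p + 1) w)).const_mul _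
  refine hd.congr_fderiv ?_
  ext v
  rw [InnerProductSpace.toDual_apply_apply, inner_eq_sum_coordSeq]
  have e1 : ∀ p ∈ Finset.range M, coordSeq (chainGrad M h' c w) p * coordSeq v p =
      h' p (coordSeq w p) * coordSeq v p + c (p + 1) * (coordSeq w (p + 1) * coordSeq v p) +
        c p * coordSeq w (p - 1) * coordSeq v p := fun p hp => by
    rw [coordSeq_chainGrad _ _ _ (Finset.mem_range.1 hp), chainPartial]; ring
  rw [Finset.sum_congr rfl e1]
  conv_rhs => rw [Finset.sum_add_distrib]
  rw [← sum_range_shift_pred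
    (fun p => c p * coordSeq w (p - 1) * coordSeq v p) (by simp [hc])
    (by simp [coordSeq_of_le v le_rfl]), ← Finset.sum_add_distrib]
  simp only [sum_apply, add_apply,
    smul_apply, smul_eq_mul, coordSeqL_apply, Nat.add_sub_cancel]
  exact Finset.sum_congr rfl fun p _ => by ring

theorem gradient_chainFun {M : ℕ} {h h' : ℕ → ℝ → ℝ} {c : ℕ → ℝ}
    (hh : ∀ p < M, ∀ x, HasDerivAt (h p) (h' p x) x) (hc : c 0 = 0) :
    gradient (chainFun M h c) = chainGrad M h' c :=
  funext fun w => (hasGradientAt_chainFun hh hc w).gradient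

/-- Schur's test for a symmetric tridiagonal matrix: weighted Cauchy–Schwarz uses the row sums once,
and summation after an index shift uses them again as column sums. -/
theorem norm_chainGrad_sub_le {M : ℕ} {h' : ℕ → ℝ → ℝ} {c a : ℕ → ℝ} {L : ℝ} (hL : 0 ≤ L)
    (ha : ∀ p < M, ∀ x y, |h' p x - h' p y| ≤ a p * |x - y|)
    (hc : c 0 = 0) (hrow : ∀ p < M, a p + |c p| + |c (p + 1)| ≤ L)
    (u v : EuclideanSpace ℝ (Fin M)) :
    ‖chainGrad M h' c u - chainGrad M h' c v‖ ≤ L * ‖u - v‖ := by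
  refine (sq_le_sq₀ (norm_nonneg _) (by positivity)).1 ?_
  rw [mul_pow, norm_sq_eq_sum_coordSeq, norm_sq_eq_sum_coordSeq]
  set d : ℕ → ℝ := fun p => coordSeq (u - v) p with hd
  have hdM : d M = 0 := coordSeq_of_le _ le_rfl
  have ha0 : ∀ p < M, 0 ≤ a p := fun p hp => by
    have := (abs_nonneg _).trans (ha p hp 1 0); simpa using this
  have hterm : ∀ p ∈ Finset.range M, coordSeq (chainGrad M h' c u - chainGrad M h' c v) p ^ 2 ≤
      L * ((a p * d p ^ 2 + |c (p + 1)| * d (p + 1) ^ 2) + |c p| * d (p - 1) ^ 2) := by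
    intro p hp
    have hp := Finset.mem_range.1 hp
    rw [coordSeq_sub, coordSeq_chainGrad _ _ _ hp, coordSeq_chainGrad _ _ _ hp]
    have e : chainPartial h' c u p - chainPartial h' c v p =
        (h' p (coordSeq u p) - h' p (coordSeq v p)) + c p * d (p - 1) + c (p + 1) * d (p + 1) := by
      simp only [hd, chainPartial, coordSeq_sub]; ring
    have h1 : |h' p (coordSeq u p) - h' p (coordSeq v p)| ≤ a p * |d p| := by
      have := ha p hp (coordSeq u p) (coordSeq v p)
      rwa [← coordSeq_sub] at this
    have h2 : |chainPartial h' c u p - chainPartial h' c v p| ≤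
        a p * |d p| + |c p| * |d (p - 1)| + |c (p + 1)| * |d (p + 1)| := by
      rw [e, ← abs_mul, ← abs_mul]
      exact (abs_add_three _ _ _).trans (by gcongr)
    have h3 : (chainPartial h' c u p - chainPartial h' c v p) ^ 2 ≤
        (a p * |d p| + |c p| * |d (p - 1)| + |c (p + 1)| * |d (p + 1)|) ^ 2 := by
      rw [← sq_abs]; gcongr
    refine h3.trans ?_
    have h4 := ha0 p hp
    have h5 := abs_nonneg (c p)
    have h6 := abs_nonneg (c (p + 1))
    rw [← sq_abs (d p), ← sq_abs (d (p + 1)), ← sq_abs (d (p - 1))]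
    generalize |d p| = x at *
    generalize |d (p + 1)| = y at *
    generalize |d (p - 1)| = z at *
    -- Cauchy–Schwarz with weights; the difference of the two sides is a weighted sum of the squares
    -- supplied to `nlinarith`.
    have hw : (a p * x + |c p| * z + |c (p + 1)| * y) ^ 2 ≤ (a p + |c p| + |c (p + 1)|) *
        ((a p * x ^ 2 + |c (p + 1)| * y ^ 2) + |c p| * z ^ 2) := by
      nlinarith [mul_nonneg (mul_nonneg h4 h5) (sq_nonneg (x - z)),
        mul_nonneg (mul_nonneg h4 h6) (sq_nonneg (x - y)),
        mul_nonneg (mul_nonneg h5 h6) (sq_nonneg (z - y))]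
    exact hw.trans (mul_le_mul_of_nonneg_right (hrow p hp) (by positivity))
  refine (Finset.sum_le_sum hterm).trans ?_
  rw [← Finset.mul_sum, pow_two, mul_assoc]
  refine mul_le_mul_of_nonneg_left ?_ hL
  rw [Finset.sum_add_distrib, Finset.sum_add_distrib,
    sum_range_shift_pred (fun p => |c p| * d p ^ 2) (by simp [hc]) (by simp [hdM])]
  have e3 : ∑ p ∈ Finset.range M, |c p| * d (p - 1) ^ 2 ≤
      ∑ p ∈ Finset.range M, |c (p + 1)| * d p ^ 2 := by
    have h1 := Finset.sum_range_succ (fun p => |c p| * d (p - 1) ^ 2) M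
    rw [Finset.sum_range_succ'] at h1
    simp only [hc, abs_zero, zero_mul, add_zero, Nat.add_sub_cancel] at h1
    have : 0 ≤ |c M| * d (M - 1) ^ 2 := by positivity
    linarith
  refine (add_le_add_right e3 _).trans ?_
  rw [← Finset.sum_add_distrib, ← Finset.sum_add_distrib, Finset.mul_sum]
  refine Finset.sum_le_sum fun p hp => ?_
  rw [← add_mul, ← add_mul]
  exact mul_le_mul_of_nonneg_right (hrow p (Finset.mem_range.1 hp)) (sq_nonneg _)

theorem isSmoothWith_chainFun {M : ℕ} {h h' : ℕ → ℝ → ℝ} {c a : ℕ → ℝ} {L : ℝ} (hL : 0 ≤ L)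
    (hh : ∀ p < M, ∀ x, HasDerivAt (h p) (h' p x) x)
    (ha : ∀ p < M, ∀ x y, |h' p x - h' p y| ≤ a p * |x - y|)
    (hc : c 0 = 0) (hrow : ∀ p < M, a p + |c p| + |c (p + 1)| ≤ L) :
    IsSmoothWith L (chainFun M h c) := by
  refine ⟨fun w => (hasGradientAt_chainFun hh hc w).differentiableAt, fun u v => ?_⟩
  rw [gradient_chainFun hh hc]
  exact norm_chainGrad_sub_le hL ha hc hrow u v

/-- The derivative of the gradient of a chain function. -/
noncomputable def chainHess (M : ℕ) (h'' : ℕ → ℝ → ℝ) (c : ℕ → ℝ) (w : EuclideanSpace ℝ (Fin M)) :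
    EuclideanSpace ℝ (Fin M) →L[ℝ] EuclideanSpace ℝ (Fin M) :=
  (PiLp.continuousLinearEquiv 2 ℝ fun _ : Fin M => ℝ).symm.toContinuousLinearMap.comp
    (ContinuousLinearMap.pi fun p : Fin M => h'' p (coordSeq w p) • coordSeqL M p +
      c p • coordSeqL M (p - 1) + c (p + 1) • coordSeqL M (p + 1))

theorem coordSeq_chainHess {M : ℕ} (h'' : ℕ → ℝ → ℝ) (c : ℕ → ℝ) (w v : EuclideanSpace ℝ (Fin M))
    {p : ℕ} (hp : p < M) : coordSeq (chainHess M h'' c w v) p =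
      h'' p (coordSeq w p) * coordSeq v p + c p * coordSeq v (p - 1) +
        c (p + 1) * coordSeq v (p + 1) := by
  simp [coordSeq, chainHess, hp]

theorem hasFDerivAt_chainGrad {M : ℕ} {h' h'' : ℕ → ℝ → ℝ} {c : ℕ → ℝ}
    (hh : ∀ p < M, ∀ x, HasDerivAt (h' p) (h'' p x) x) (w : EuclideanSpace ℝ (Fin M)) :
    HasFDerivAt (chainGrad M h' c) (chainHess M h'' c w) w := by
  have hd : HasFDerivAt (fun w : EuclideanSpace ℝ (Fin M) => fun p : Fin M => chainPartial h' c w p)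
      (ContinuousLinearMap.pi fun p : Fin M => h'' p (coordSeq w p) • coordSeqL M p +
        c p • coordSeqL M (p - 1) + c (p + 1) • coordSeqL M (p + 1)) w := by
    rw [hasFDerivAt_pi]
    intro p
    refine HasFDerivAt.add (HasFDerivAt.add ?_ ?_) ?_
    · exact (hh p p.2 _).comp_hasFDerivAt w (hasFDerivAt_coordSeq p w)
    · exact (hasFDerivAt_coordSeq _ w).const_mul _
    · exact (hasFDerivAt_coordSeq _ w).const_mul _
  exact ((PiLp.continuousLinearEquiv 2 ℝ fun _ : Fin M => ℝ).symm.toContinuousLinearMap.hasFDerivAt).comp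
    w hd

/-- The couplings are quadratic, so they cancel in a difference of Hessians; what remains is
diagonal and its norm is governed entry by entry. -/
theorem hasLipschitzHessian_chainFun {M : ℕ} {h h' h'' : ℕ → ℝ → ℝ} {c : ℕ → ℝ} {L : ℝ}
    (hL : 0 ≤ L) (hh : ∀ p < M, ∀ x, HasDerivAt (h p) (h' p x) x)
    (hh' : ∀ p < M, ∀ x, HasDerivAt (h' p) (h'' p x) x)
    (ha : ∀ p < M, ∀ x y, |h'' p x - h'' p y| ≤ L * |x - y|) (hc : c 0 = 0) :
    HasLipschitzHessian L (chainFun M h c) := by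
  refine ⟨fun w => (hasGradientAt_chainFun hh hc w).differentiableAt, ?_, fun u v => ?_⟩
  · rw [gradient_chainFun hh hc]
    exact fun w => (hasFDerivAt_chainGrad hh' w).differentiableAt
  rw [gradient_chainFun hh hc, (hasFDerivAt_chainGrad hh' u).fderiv,
    (hasFDerivAt_chainGrad hh' v).fderiv]
  refine ContinuousLinearMap.opNorm_le_bound _ (by positivity) fun z => ?_
  refine (sq_le_sq₀ (norm_nonneg _) (by positivity)).1 ?_
  rw [mul_pow, norm_sq_eq_sum_coordSeq, norm_sq_eq_sum_coordSeq z, Finset.mul_sum]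
  refine Finset.sum_le_sum fun p hp => ?_
  have hp' := Finset.mem_range.1 hp
  rw [sub_apply, coordSeq_sub, coordSeq_chainHess _ _ _ _ hp',
    coordSeq_chainHess _ _ _ _ hp']
  have e : h'' p (coordSeq u p) * coordSeq z p + c p * coordSeq z (p - 1) +
        c (p + 1) * coordSeq z (p + 1) - (h'' p (coordSeq v p) * coordSeq z p +
        c p * coordSeq z (p - 1) + c (p + 1) * coordSeq z (p + 1)) =
      (h'' p (coordSeq u p) - h'' p (coordSeq v p)) * coordSeq z p := by ring
  rw [e, mul_pow]
  refine mul_le_mul_of_nonneg_right ?_ (sq_nonneg _)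
  rw [← sq_abs]
  refine pow_le_pow_left₀ (abs_nonneg _) ((ha p hp' _ _).trans ?_) 2
  refine mul_le_mul_of_nonneg_left ?_ hL
  rw [← coordSeq_sub]
  refine abs_le_of_sq_le_sq ?_ (norm_nonneg _)
  rw [norm_sq_eq_sum_coordSeq]
  exact Finset.single_le_sum (f := fun p => coordSeq (u - v) p ^ 2) (fun _ _ => sq_nonneg _) hp

/-- The gradient of a chain function discovers at most one further coordinate. -/
theorem chainGrad_eq_zero_of_support {M t : ℕ} {h' : ℕ → ℝ → ℝ} {c : ℕ → ℝ}
    (h0 : ∀ p, 0 < p → p < M → h' p 0 = 0) {w : EuclideanSpace ℝ (Fin M)}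
    (hw : ∀ p, t ≤ p → coordSeq w p = 0) {p : ℕ} (hp : t + 1 ≤ p) :
    coordSeq (chainGrad M h' c w) p = 0 := by
  rcases lt_or_ge p M with hpM | hpM
  · rw [coordSeq_chainGrad _ _ _ hpM, chainPartial, hw p (by omega), hw (p - 1) (by omega),
      hw (p + 1) (by omega), h0 p (by omega) hpM]
    ring
  · exact coordSeq_of_le _ hpM

/-! ### The joint space as one chain, and the spread of information along it. -/

/-- The isometry that arranges the coordinates of the joint space along a chain. -/
noncomputable def chainIso {n m M : ℕ} (e : Fin n ⊕ Fin m ≃ Fin M) :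
    JointSpace n m ≃ₗᵢ[ℝ] EuclideanSpace ℝ (Fin M) :=
  (PiLp.sumPiLpEquivProdLpPiLp 2 fun _ : Fin n ⊕ Fin m => ℝ).symm.trans
    (LinearIsometryEquiv.piLpCongrLeft 2 ℝ ℝ e)

theorem coordSeq_chainIso {n m M : ℕ} (e : Fin n ⊕ Fin m ≃ Fin M) (z : JointSpace n m)
    (k : Fin n ⊕ Fin m) :
    coordSeq (chainIso e z) (e k) = Sum.elim (fun i => z.fst i) (fun j => z.snd j) k := by
  rw [coordSeq_fin]
  cases k <;> simp [chainIso, LinearIsometryEquiv.piLpCongrLeft_apply]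

theorem coordSeq_chainIso_inl {n m M : ℕ} (e : Fin n ⊕ Fin m ≃ Fin M) (z : JointSpace n m) {p : ℕ}
    (hp : p < n) :
    coordSeq (chainIso e z) (e (Sum.inl ⟨p, hp⟩)) = coordSeq z.fst p := by
  rw [coordSeq_chainIso]
  simp [coordSeq, hp]

theorem joint_fst {n m : ℕ} (x : EuclideanSpace ℝ (Fin n)) (y : EuclideanSpace ℝ (Fin m)) :
    (joint x y).fst = x := rfl

theorem joint_snd {n m : ℕ} (x : EuclideanSpace ℝ (Fin n)) (y : EuclideanSpace ℝ (Fin m)) :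
    (joint x y).snd = y := rfl

theorem hasGradientAt_comp_isometry {E F : Type*} [NormedAddCommGroup E] [InnerProductSpace ℝ E]
    [CompleteSpace E] [NormedAddCommGroup F] [InnerProductSpace ℝ F] [CompleteSpace F]
    (J : E ≃ₗᵢ[ℝ] F) {g : F → ℝ} (hg : Differentiable ℝ g) (z : E) :
    HasGradientAt (g ∘ J) (J.symm (gradient g (J z))) z := by
  rw [hasGradientAt_iff_hasFDerivAt]
  have h1 := (hg (J z)).hasGradientAt.hasFDerivAt.comp z
    (J.toContinuousLinearEquiv.toContinuousLinearMap.hasFDerivAt (x := z))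
  refine h1.congr_fderiv ?_
  ext v
  rw [InnerProductSpace.toDual_apply_apply, ContinuousLinearMap.comp_apply,
    InnerProductSpace.toDual_apply_apply, ← J.inner_map_map, J.apply_symm_apply]
  rfl

theorem IsSmoothWith.comp_isometry {E F : Type*} [NormedAddCommGroup E] [InnerProductSpace ℝ E]
    [CompleteSpace E] [NormedAddCommGroup F] [InnerProductSpace ℝ F] [CompleteSpace F] {L : ℝ}
    {g : F → ℝ} (hg : IsSmoothWith L g) (J : E ≃ₗᵢ[ℝ] F) : IsSmoothWith L (g ∘ J) := by
  refine ⟨fun z => (hasGradientAt_comp_isometry J hg.1 z).differentiableAt, fun u v => ?_⟩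
  rw [(hasGradientAt_comp_isometry J hg.1 u).gradient, (hasGradientAt_comp_isometry J hg.1 v).gradient,
    ← map_sub, J.symm.norm_map]
  refine (hg.2 _ _).trans_eq ?_
  rw [← map_sub, J.norm_map]

/-- After `t` gradient evaluations of a chain function only the first `t` coordinates of the chain
have been discovered. -/
theorem coordSeq_eq_zero_of_isFirstOrderSequence {n m M : ℕ} (e : Fin n ⊕ Fin m ≃ Fin M)
    {h h' : ℕ → ℝ → ℝ} {c : ℕ → ℝ} (hh : ∀ p < M, ∀ x, HasDerivAt (h p) (h' p x) x) (hc : c 0 = 0)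
    (h0 : ∀ p, 0 < p → p < M → h' p 0 = 0) {z : ℕ → JointSpace n m}
    (hz : IsFirstOrderSequence (chainFun M h c ∘ chainIso e) z) (t : ℕ) :
    ∀ p, t ≤ p → coordSeq (chainIso e (z t)) p = 0 := by
  have hd : Differentiable ℝ (chainFun M h c) := fun w =>
    (hasGradientAt_chainFun hh hc w).differentiableAt
  induction t using Nat.strong_induction_on with
  | _ t ih =>
    intro p hp
    rcases lt_or_ge p M with hpM | hpM
    swap
    · exact coordSeq_of_le _ hpM
    obtain ⟨k, hk⟩ := e.surjective ⟨p, hpM⟩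
    have hk' : (e k : ℕ) = p := by rw [hk]
    cases t with
    | zero => rw [hz.1, map_zero]; simp [coordSeq]
    | succ t =>
      by_contra hne
      rw [← hk', coordSeq_chainIso] at hne
      have hmem := hz.2 t hne
      simp only [Set.mem_iUnion, Set.mem_Iic, exists_prop, Set.mem_union] at hmem
      obtain ⟨i, hi, hmem | hmem⟩ := hmem
      · refine hmem ?_
        rw [← coordSeq_chainIso e, hk']
        exact ih i (by omega) p (by omega)
      · refine hmem ?_
        rw [← coordSeq_chainIso e, hk', (hasGradientAt_comp_isometry _ hd _).gradient,
          LinearIsometryEquiv.apply_symm_apply, gradient_chainFun hh hc]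
        exact chainGrad_eq_zero_of_support h0 (ih i (by omega)) (by omega)

/-- An arrangement of `N` blocks, each consisting of one coordinate of the first kind followed by
`n + 1` coordinates of the second kind. -/
theorem exists_block_equiv (N n : ℕ) :
    ∃ e : Fin N ⊕ Fin (N * (n + 1)) ≃ Fin (N * (n + 2)),
      ∀ i : Fin N, (e (Sum.inl i) : ℕ) = i * (n + 2) := by
  refine ⟨((Equiv.sumCongr (Equiv.prodUnique (Fin N) (Fin 1)).symm finProdFinEquiv.symm).trans
    (Equiv.prodSumDistrib _ _ _).symm).trans
      ((Equiv.prodCongr (Equiv.refl _) finSumFinEquiv).trans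
        (finProdFinEquiv.trans (finCongr (by ring)))), fun i => ?_⟩
  simp
  ring

/-! ### The hard primal function. -/

/-- The number of neighbours of the node `i` in a path with `N` nodes. -/
noncomputable def pathDeg (N i : ℕ) : ℝ :=
  (if i + 1 < N then 1 else 0) + (if 0 < i then 1 else 0)

theorem pathDeg_nonneg (N i : ℕ) : 0 ≤ pathDeg N i := by
  unfold pathDeg; split_ifs <;> norm_num

theorem pathDeg_le (N i : ℕ) : pathDeg N i ≤ 2 := by
  unfold pathDeg; split_ifs <;> norm_num

/-- The term of the hard instance in the `i`-th coordinate, with quadratic part of weight `κ`. -/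
noncomputable def nodeFun (N : ℕ) (lam σ r κ : ℝ) (i : ℕ) (x : ℝ) : ℝ :=
  κ / 2 * pathDeg N i * x ^ 2 + (if i = 0 then lam * r / 2 * (x - σ) ^ 2 else 0) +
    lam * σ ^ 2 * r ^ 2 * bend (x / σ)

/-- The derivative of `nodeFun`. -/
noncomputable def nodeFun' (N : ℕ) (lam σ r κ : ℝ) (i : ℕ) (x : ℝ) : ℝ :=
  κ * pathDeg N i * x + (if i = 0 then lam * r * (x - σ) else 0) +
    lam * σ * r ^ 2 * bendDeriv (x / σ)

/-- The second derivative of `nodeFun`. -/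
noncomputable def nodeFun'' (N : ℕ) (lam σ r κ : ℝ) (i : ℕ) (x : ℝ) : ℝ :=
  κ * pathDeg N i + (if i = 0 then lam * r else 0) + lam * r ^ 2 * bendDeriv₂ (x / σ)

theorem hasDerivAt_nodeFun {σ : ℝ} (hσ : σ ≠ 0) (N : ℕ) (lam r κ : ℝ) (i : ℕ) (x : ℝ) :
    HasDerivAt (nodeFun N lam σ r κ i) (nodeFun' N lam σ r κ i x) x := by
  have h1 : HasDerivAt (fun x : ℝ => κ / 2 * pathDeg N i * x ^ 2) (κ * pathDeg N i * x) x :=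
    ((hasDerivAt_pow 2 x).const_mul (κ / 2 * pathDeg N i)).congr_deriv (by push_cast; ring)
  have h2 : HasDerivAt (fun x : ℝ => if i = 0 then lam * r / 2 * (x - σ) ^ 2 else 0)
      (if i = 0 then lam * r * (x - σ) else 0) x := by
    split_ifs
    · exact ((((hasDerivAt_id x).sub_const σ).pow 2).const_mul (lam * r / 2)).congr_deriv
        (by simp; ring)
    · exact hasDerivAt_const x 0
  have h3 : HasDerivAt (fun x : ℝ => lam * σ ^ 2 * r ^ 2 * bend (x / σ))
      (lam * σ * r ^ 2 * bendDeriv (x / σ)) x :=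
    (((hasDerivAt_bend (x / σ)).comp x ((hasDerivAt_id x).div_const σ)).const_mul
      (lam * σ ^ 2 * r ^ 2)).congr_deriv (by field_simp)
  exact (h1.add h2).add h3

theorem hasDerivAt_nodeFun' {σ : ℝ} (hσ : σ ≠ 0) (N : ℕ) (lam r κ : ℝ) (i : ℕ) (x : ℝ) :
    HasDerivAt (nodeFun' N lam σ r κ i) (nodeFun'' N lam σ r κ i x) x := by
  have h1 : HasDerivAt (fun x : ℝ => κ * pathDeg N i * x) (κ * pathDeg N i) x :=
    ((hasDerivAt_id x).const_mul (κ * pathDeg N i)).congr_deriv (by simp)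
  have h2 : HasDerivAt (fun x : ℝ => if i = 0 then lam * r * (x - σ) else 0)
      (if i = 0 then lam * r else 0) x := by
    split_ifs
    · exact (((hasDerivAt_id x).sub_const σ).const_mul (lam * r)).congr_deriv (by simp)
    · exact hasDerivAt_const x 0
  have h3 : HasDerivAt (fun x : ℝ => lam * σ * r ^ 2 * bendDeriv (x / σ))
      (lam * r ^ 2 * bendDeriv₂ (x / σ)) x :=
    (((hasDerivAt_bendDeriv (x / σ)).comp x ((hasDerivAt_id x).div_const σ)).const_mul
      (lam * σ * r ^ 2)).congr_deriv (by field_simp)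
  exact (h1.add h2).add h3

theorem nodeFun'_zero {N : ℕ} {lam σ r κ : ℝ} {i : ℕ} (hi : 0 < i) :
    nodeFun' N lam σ r κ i 0 = 0 := by
  simp [nodeFun', bendDeriv_zero, hi.ne']

theorem abs_nodeFun'_sub_le {N : ℕ} {lam σ r κ : ℝ} (hlam : 0 ≤ lam) (hσ : 0 < σ) (hr : 0 ≤ r)
    (hr1 : r ≤ 1) (hκ : |κ| ≤ lam) (i : ℕ) (x y : ℝ) :
    |nodeFun' N lam σ r κ i x - nodeFun' N lam σ r κ i y| ≤ 9 * lam * |x - y| := by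
  have hr2 : r ^ 2 ≤ 1 := pow_le_one₀ hr hr1
  have hb : ∀ z, ‖nodeFun'' N lam σ r κ i z‖ ≤ 9 * lam := fun z => by
    have h1 : |κ * pathDeg N i| ≤ lam * 2 := by
      rw [abs_mul, abs_of_nonneg (pathDeg_nonneg N i)]
      exact mul_le_mul hκ (pathDeg_le N i) (pathDeg_nonneg N i) hlam
    have h2 : |if i = 0 then lam * r else 0| ≤ lam := by
      split_ifs
      · rw [abs_of_nonneg (by positivity)]; nlinarith
      · simpa using hlam
    have h3 : |lam * r ^ 2 * bendDeriv₂ (z / σ)| ≤ lam * 1 * 6 := by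
      rw [abs_mul, abs_of_nonneg (by positivity : 0 ≤ lam * r ^ 2)]
      exact mul_le_mul (by gcongr) (abs_bendDeriv₂_le _) (abs_nonneg _) (by positivity)
    rw [Real.norm_eq_abs]
    unfold nodeFun''
    refine (abs_add_three _ _ _).trans ?_
    linarith
  have := (convex_univ (𝕜 := ℝ) (E := ℝ)).norm_image_sub_le_of_norm_hasDerivWithin_le
    (f := nodeFun' N lam σ r κ i)
    (fun z _ => (hasDerivAt_nodeFun' hσ.ne' N lam r κ i z).hasDerivWithinAt)
    (fun z _ => hb z) (Set.mem_univ y) (Set.mem_univ x)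
  simpa [Real.norm_eq_abs] using this

theorem abs_nodeFun''_sub_le {N : ℕ} {lam σ r κ : ℝ} (hlam : 0 ≤ lam) (hσ : 0 < σ) (i : ℕ)
    (x y : ℝ) : |nodeFun'' N lam σ r κ i x - nodeFun'' N lam σ r κ i y| ≤
      9 * (lam * r ^ 2 / σ) * |x - y| := by
  have e : nodeFun'' N lam σ r κ i x - nodeFun'' N lam σ r κ i y =
      lam * r ^ 2 * (bendDeriv₂ (x / σ) - bendDeriv₂ (y / σ)) := by unfold nodeFun''; ring
  rw [e, abs_mul, abs_of_nonneg (by positivity)]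
  have h := abs_bendDeriv₂_sub_le (x / σ) (y / σ)
  rw [← sub_div, abs_div, abs_of_pos hσ] at h
  calc _ ≤ lam * r ^ 2 * (9 * (|x - y| / σ)) := by gcongr
    _ = _ := by ring

/-- The coupling of neighbouring nodes in the primal function. -/
noncomputable def primalLink (N : ℕ) (lam : ℝ) (i : ℕ) : ℝ := if 0 < i ∧ i < N then -lam else 0

/-- The hard primal function. -/
noncomputable def hardPrimal (N : ℕ) (lam σ r : ℝ) : EuclideanSpace ℝ (Fin N) → ℝ :=
  chainFun N (nodeFun N lam σ r lam) (primalLink N lam)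

theorem hasLipschitzHessian_hardPrimal (N : ℕ) {lam σ : ℝ} (hlam : 0 ≤ lam) (hσ : 0 < σ) (r : ℝ) :
    HasLipschitzHessian (9 * (lam * r ^ 2 / σ)) (hardPrimal N lam σ r) :=
  hasLipschitzHessian_chainFun (by positivity) (fun p _ => hasDerivAt_nodeFun hσ.ne' N lam r lam p)
    (fun p _ => hasDerivAt_nodeFun' hσ.ne' N lam r lam p)
    (fun p _ => abs_nodeFun''_sub_le hlam hσ p) (by simp [primalLink])

/-- Summation over the nodes of a path weighted by degree. -/
theorem sum_pathDeg_mul (N : ℕ) (F : ℕ → ℝ) :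
    ∑ i ∈ Finset.range N, pathDeg N i * F i =
      ∑ i ∈ Finset.range N, (if i + 1 < N then F i + F (i + 1) else 0) := by
  have h := sum_range_shift_pred (M := N) (fun i => if 0 < i ∧ i < N then F i else 0) (by simp)
    (by simp)
  have e1 : ∀ i ∈ Finset.range N, pathDeg N i * F i =
      (if i + 1 < N then F i else 0) + (if 0 < i ∧ i < N then F i else 0) := fun i hi => by
    have := Finset.mem_range.1 hi
    simp only [pathDeg, this, and_true]
    split_ifs <;> ring
  rw [Finset.sum_congr rfl e1, Finset.sum_add_distrib, ← h, ← Finset.sum_add_distrib]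
  refine Finset.sum_congr rfl fun i _ => ?_
  simp only [Nat.succ_pos, true_and]
  split_ifs <;> ring

/-- Splitting the degree-weighted squares among the edges completes each coupling to a spring
energy, which makes all terms except the potential nonnegative. -/
theorem hardPrimal_eq (N : ℕ) (lam σ r : ℝ) (x : EuclideanSpace ℝ (Fin N)) :
    hardPrimal N lam σ r x = ∑ i ∈ Finset.range N,
      ((if i + 1 < N then lam / 2 * (coordSeq x i - coordSeq x (i + 1)) ^ 2 else 0) +
        (if i = 0 then lam * r / 2 * (coordSeq x i - σ) ^ 2 else 0) +
        lam * σ ^ 2 * r ^ 2 * bend (coordSeq x i / σ)) := by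
  have h := sum_pathDeg_mul N fun i => lam / 2 * coordSeq x i ^ 2
  have e1 : hardPrimal N lam σ r x = ∑ i ∈ Finset.range N,
      pathDeg N i * (lam / 2 * coordSeq x i ^ 2) + ∑ i ∈ Finset.range N,
      ((if i + 1 < N then -lam * (coordSeq x i * coordSeq x (i + 1)) else 0) +
        (if i = 0 then lam * r / 2 * (coordSeq x i - σ) ^ 2 else 0) +
        lam * σ ^ 2 * r ^ 2 * bend (coordSeq x i / σ)) := by
    rw [← Finset.sum_add_distrib, hardPrimal, chainFun]
    refine Finset.sum_congr rfl fun i _ => ?_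
    simp only [nodeFun, primalLink, Nat.succ_pos, true_and, ite_mul, zero_mul]
    ring
  rw [e1, h, ← Finset.sum_add_distrib]
  refine Finset.sum_congr rfl fun i _ => ?_
  split_ifs <;> ring

/-- The vector with all entries σ minimizes every term separately. At the origin the boundary spring
costs lam * σ² * r / 2, and each node at most lam * σ² * r² more than at σ. -/
theorem exists_min_hardPrimal (N : ℕ) {lam σ r : ℝ} (hlam : 0 ≤ lam) (hσ : 0 < σ) (hr : 0 ≤ r) :
    ∃ xmin, (∀ x, hardPrimal N lam σ r xmin ≤ hardPrimal N lam σ r x) ∧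
      hardPrimal N lam σ r 0 - hardPrimal N lam σ r xmin ≤
        lam * σ ^ 2 * (r / 2 + N * r ^ 2) := by
  set xmin : EuclideanSpace ℝ (Fin N) := WithLp.toLp 2 fun _ => σ with hxmin
  have hc : ∀ i < N, coordSeq xmin i = σ := fun i hi => coordSeq_toLp (fun _ => σ) hi
  have hmin : hardPrimal N lam σ r xmin =
      ∑ i ∈ Finset.range N, lam * σ ^ 2 * r ^ 2 * bend 1 := by
    rw [hardPrimal_eq]
    refine Finset.sum_congr rfl fun i hi => ?_
    rw [hc i (Finset.mem_range.1 hi), div_self hσ.ne']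
    have : (if i + 1 < N then lam / 2 * (σ - coordSeq xmin (i + 1)) ^ 2 else 0) = 0 := by
      split_ifs with h
      · rw [hc _ h]; ring
      · rfl
    rw [this]
    simp
  refine ⟨xmin, fun x => ?_, ?_⟩
  · rw [hmin, hardPrimal_eq]
    refine Finset.sum_le_sum fun i _ => ?_
    have h1 : 0 ≤ (if i + 1 < N then lam / 2 * (coordSeq x i - coordSeq x (i + 1)) ^ 2 else 0) := by
      split_ifs <;> positivity
    have h2 : 0 ≤ (if i = 0 then lam * r / 2 * (coordSeq x i - σ) ^ 2 else 0) := by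
      split_ifs <;> positivity
    have h3 := mul_le_mul_of_nonneg_left (bend_one_le (coordSeq x i / σ))
      (by positivity : 0 ≤ lam * σ ^ 2 * r ^ 2)
    linarith
  · rw [hmin, hardPrimal_eq, ← Finset.sum_sub_distrib]
    have hz : ∀ i, coordSeq (0 : EuclideanSpace ℝ (Fin N)) i = 0 := fun i => by simp [coordSeq]
    simp only [hz]
    have h1 : ∀ i ∈ Finset.range N, (if i + 1 < N then lam / 2 * ((0 : ℝ) - 0) ^ 2 else 0) +
        (if i = 0 then lam * r / 2 * (0 - σ) ^ 2 else 0) +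
        lam * σ ^ 2 * r ^ 2 * bend (0 / σ) - lam * σ ^ 2 * r ^ 2 * bend 1 ≤
        (if i = 0 then lam * r / 2 * σ ^ 2 else 0) + lam * σ ^ 2 * r ^ 2 := fun i _ => by
      have h3 := mul_le_mul_of_nonneg_left bend_zero_sub_bend_one_le
        (by positivity : 0 ≤ lam * σ ^ 2 * r ^ 2)
      rw [zero_div]
      split_ifs <;> nlinarith
    refine (Finset.sum_le_sum h1).trans ?_
    rw [Finset.sum_add_distrib, Finset.sum_ite_eq', Finset.sum_const, Finset.card_range,
      nsmul_eq_mul]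
    have : (if 0 ∈ Finset.range N then lam * r / 2 * σ ^ 2 else 0) ≤ lam * r / 2 * σ ^ 2 := by
      split_ifs
      · exact le_rfl
      · positivity
    linarith

theorem lt_norm_gradient_hardPrimal {N : ℕ} (hN : 1 ≤ N) {lam σ θ : ℝ} (hlam : 0 < lam)
    (hσ : 0 < σ) (hθ : 0 < θ) (hθ1 : θ ≤ 1) {x : EuclideanSpace ℝ (Fin N)}
    (hx : coordSeq x (N - 1) = 0) :
    lam * σ * θ ^ 3 / 10000 < ‖gradient (hardPrimal N lam σ (θ ^ 2)) x‖ := by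
  set r := θ ^ 2 with hr
  have hgrad : gradient (hardPrimal N lam σ r) x =
      chainGrad N (nodeFun' N lam σ r lam) (primalLink N lam) x := by
    rw [hardPrimal, gradient_chainFun (fun p _ => hasDerivAt_nodeFun hσ.ne' N lam r lam p)
      (by simp [primalLink])]
  set g : ℕ → ℝ := fun i => coordSeq (gradient (hardPrimal N lam σ r) x) i / (lam * σ) with hg
  -- Node i sits at index i + 1; index 0 is a phantom node placed so that the boundary spring
  -- becomes an ordinary slope, s 0 = r * (1 - Y 1). Setting s to 0 from N on encodes the free end.
  set Y : ℕ → ℝ := fun i => if i = 0 then coordSeq x 0 / σ + r * (1 - coordSeq x 0 / σ)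
    else coordSeq x (i - 1) / σ with hY
  set s : ℕ → ℝ := fun i => if i < N then Y i - Y (i + 1) else 0 with hs
  have hY0 : Y 0 = coordSeq x 0 / σ + r * (1 - coordSeq x 0 / σ) := by simp [hY]
  have hYs : ∀ i, Y (i + 1) = coordSeq x i / σ := fun i => by simp [hY]
  have key := chain_force_lower_bound (N := N) (r := r) (Y := Y) (s := s) (g := g) (by positivity)
    (pow_le_one₀ hθ.le hθ1) hN
    (by simp only [hs, if_pos (show 0 < N by omega), hY0, hYs]; ring)
    (fun i hi => by simp only [hs, if_pos hi]) (by simp [hs]) ?_ ?_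
  · have h1 : ∑ i ∈ Finset.range N, g i ^ 2 =
        ‖gradient (hardPrimal N lam σ r) x‖ ^ 2 / (lam * σ) ^ 2 := by
      rw [norm_sq_eq_sum_coordSeq, Finset.sum_div]
      simp only [hg, div_pow]
    rw [h1, lt_div_iff₀ (by positivity)] at key
    refine lt_of_pow_lt_pow_left₀ 2 (norm_nonneg _) (lt_of_le_of_lt (le_of_eq ?_) key)
    rw [hr]
    ring
  · intro i hi
    rw [hYs]
    simp only [hg, hs, if_pos hi, hgrad, coordSeq_chainGrad _ _ _ hi, chainPartial, nodeFun',
      primalLink, hYs, pathDeg]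
    rcases Nat.eq_zero_or_pos i with rfl | hi0
    · by_cases hN1 : 0 + 1 < N
      · simp only [hN1, hY0, if_true, lt_irrefl, if_false, false_and, Nat.succ_pos, true_and]
        field_simp
        ring
      · simp only [hN1, hY0, if_true, lt_irrefl, if_false, false_and, Nat.succ_pos,
          true_and]
        field_simp
        ring
    · obtain ⟨k, rfl⟩ : ∃ k, i = k + 1 := ⟨i - 1, by omega⟩
      by_cases hN1 : k + 1 + 1 < N
      · simp only [hN1, hi, hYs, if_true, if_false, Nat.succ_pos, true_and, Nat.succ_ne_zero,
          Nat.add_sub_cancel]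
        field_simp
        ring
      · simp only [hN1, hi, hYs, if_true, if_false, Nat.succ_pos, true_and, Nat.succ_ne_zero,
          Nat.add_sub_cancel]
        field_simp
        ring
  · obtain ⟨k, rfl⟩ : ∃ k, N = k + 1 := ⟨N - 1, by omega⟩
    rw [Nat.add_sub_cancel] at hx
    rw [hYs, hx, zero_div]

/-! ### Realization with a decoupled maximization variable. -/

/-- The instance for bounded condition number: the maximization variable is decoupled. -/
theorem exists_decoupled_instance {N : ℕ} {lam σ r μ : ℝ} (hlam : 0 < lam)
    (hσ : 0 < σ) (hr : 0 ≤ r) (hr1 : r ≤ 1) (hμ : 0 < μ) (hμl : μ ≤ 13 * lam) :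
    ∃ f : JointSpace N 1 → ℝ, IsSmoothWith (13 * lam) f ∧ IsStronglyConcaveInY μ f ∧
      IsPrimalFunction f (hardPrimal N lam σ r) ∧
      ∀ z : ℕ → JointSpace N 1, IsFirstOrderSequence f z → ∀ t ≤ N - 1,
        coordSeq (z t).fst (N - 1) = 0 := by
  set e : Fin N ⊕ Fin 1 ≃ Fin (N + 1) := finSumFinEquiv with he
  set h : ℕ → ℝ → ℝ := fun p x => if p < N then nodeFun N lam σ r lam p x else -(μ / 2) * x ^ 2
    with hh
  set h' : ℕ → ℝ → ℝ := fun p x => if p < N then nodeFun' N lam σ r lam p x else -μ * x with hh'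
  set c := primalLink N lam with hc
  have hc0 : c 0 = 0 := by simp [hc, primalLink]
  have hcN : c N = 0 := by simp [hc, primalLink]
  have hder : ∀ p < N + 1, ∀ x, HasDerivAt (h p) (h' p x) x := by
    intro p _ x
    by_cases hp : p < N
    · simp only [hh, hh', hp, if_true]
      exact hasDerivAt_nodeFun hσ.ne' N lam r lam p x
    · simp only [hh, hh', hp, if_false]
      exact ((hasDerivAt_pow 2 x).const_mul (-(μ / 2))).congr_deriv (by push_cast; ring)
  have hW : ∀ (z : JointSpace N 1), ∀ p < N, coordSeq (chainIso e z) p = coordSeq z.fst p := by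
    intro z p hp
    rw [← coordSeq_chainIso_inl e z hp]
    simp [he]
  have hWN : ∀ (z : JointSpace N 1), coordSeq (chainIso e z) N = z.snd 0 := by
    intro z
    have := coordSeq_chainIso e z (Sum.inr 0)
    simpa [he] using this
  have hval : ∀ z : JointSpace N 1, chainFun (N + 1) h c (chainIso e z) =
      hardPrimal N lam σ r z.fst - μ / 2 * z.snd 0 ^ 2 := by
    intro z
    have e1 : h N (coordSeq (chainIso e z) N) = -(μ / 2) * z.snd 0 ^ 2 := by
      simp only [hh, lt_irrefl, if_false, hWN]
    rw [chainFun, Finset.sum_range_succ, e1, coordSeq_of_le _ le_rfl, hardPrimal, chainFun]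
    have e2 : ∀ p ∈ Finset.range N, h p (coordSeq (chainIso e z) p) + c (p + 1) *
        (coordSeq (chainIso e z) p * coordSeq (chainIso e z) (p + 1)) =
        nodeFun N lam σ r lam p (coordSeq z.fst p) + primalLink N lam (p + 1) *
          (coordSeq z.fst p * coordSeq z.fst (p + 1)) := by
      intro p hp
      have hp := Finset.mem_range.1 hp
      rw [hW z p hp]
      simp only [hh, hp, if_true]
      rcases Nat.lt_or_ge (p + 1) N with h1 | h1
      · rw [hW z _ h1]
      · rw [show p + 1 = N by omega, hcN, ← hc, hcN]; ring
    rw [Finset.sum_congr rfl e2]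
    ring
  refine ⟨chainFun (N + 1) h c ∘ chainIso e, IsSmoothWith.comp_isometry ?_ _, fun x => ?_,
    fun x => ⟨⟨0, ?_⟩, ?_⟩, ?_⟩
  · refine isSmoothWith_chainFun (a := fun p => if p < N then 9 * lam else μ) (by positivity) hder
      ?_ hc0 ?_
    · intro p _ x y
      by_cases hp : p < N
      · simp only [hh', hp, if_true]
        exact abs_nodeFun'_sub_le hlam.le hσ hr hr1 (abs_of_pos hlam).le p x y
      · simp only [hh', hp, if_false]
        rw [← mul_sub, abs_mul, abs_neg, abs_of_pos hμ]
    · intro p hp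
      have hcl : ∀ i, |c i| ≤ lam := fun i => by
        simp only [hc, primalLink]
        split_ifs
        · rw [abs_neg, abs_of_pos hlam]
        · simpa using hlam.le
      by_cases hpN : p < N
      · simp only [hpN, if_true]
        linarith [hcl p, hcl (p + 1)]
      · have hcN1 : c (N + 1) = 0 := by simp [hc, primalLink]
        simp only [hpN, if_false]
        rw [show p = N by omega, hcN, hcN1]
        simpa using hμl
  · refine ⟨convex_univ, fun y _ z _ a b _ _ hab => ?_⟩
    simp only [Function.comp_apply, hval, joint_fst, joint_snd, smul_eq_mul, EuclideanSpace.norm_sq_eq,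
      Fin.sum_univ_one, PiLp.add_apply, PiLp.smul_apply, PiLp.sub_apply, Real.norm_eq_abs, sq_abs]
    obtain rfl : b = 1 - a := by linarith
    exact le_of_eq (by ring)
  · simp [hval]
  · rintro _ ⟨y, rfl⟩
    simp only [Function.comp_apply, hval]
    have : 0 ≤ μ / 2 * y 0 ^ 2 := by positivity
    simpa using this
  · intro z hz t ht
    have h1 := coordSeq_eq_zero_of_isFirstOrderSequence e hder hc0 (fun p hp hpN => ?_) hz t
      (N - 1) ht
    · rcases Nat.eq_zero_or_pos N with h0 | h0
      · exact coordSeq_of_le _ (by omega)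
      · rwa [hW _ _ (by omega)] at h1
    · simp only [hh']
      split_ifs
      · exact nodeFun'_zero hp
      · simp

/-! ### Realization in which nodes communicate through blocks of y. -/

/-- The sum of squares of one block of the maximization variable, driven by the neighbouring nodes
`A` and `V`. -/
noncomputable def blockSq (n : ℕ) (q A V : ℝ) (y : ℕ → ℝ) : ℝ :=
  (1 - q ^ 2) * (y 0 - A + q ^ n * V) ^ 2 + ∑ k ∈ Finset.range n,
    (y (k + 1) - q * y k + (1 - q ^ 2) * q ^ (n - 1 - k) * V) ^ 2

theorem blockSq_nonneg {n : ℕ} {q A V : ℝ} (hq : 0 ≤ q) (hq1 : q ≤ 1) (y : ℕ → ℝ) :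
    0 ≤ blockSq n q A V y := by
  have : 0 ≤ 1 - q ^ 2 := by nlinarith
  unfold blockSq
  positivity

theorem blockSq_succ (n : ℕ) (q A V : ℝ) (y : ℕ → ℝ) :
    blockSq (n + 1) q A V y =
      blockSq n q A (q * V) y + (y (n + 1) - q * y n + (1 - q ^ 2) * V) ^ 2 := by
  unfold blockSq
  rw [Finset.sum_range_succ]
  have : ∀ k ∈ Finset.range n,
      (y (k + 1) - q * y k + (1 - q ^ 2) * q ^ (n + 1 - 1 - k) * V) ^ 2 =
      (y (k + 1) - q * y k + (1 - q ^ 2) * q ^ (n - 1 - k) * (q * V)) ^ 2 := fun k hk => by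
    have hk := Finset.mem_range.1 hk
    rw [show n + 1 - 1 - k = n - 1 - k + 1 by omega, pow_succ]
    ring
  rw [Finset.sum_congr rfl this]
  simp only [Nat.add_sub_cancel, Nat.sub_self, pow_zero]
  ring

/-- The diagonal coefficients of the quadratic form of a block. -/
noncomputable def blockDiag (n : ℕ) (q : ℝ) (k : ℕ) : ℝ :=
  (if k = 0 then 1 - q ^ 2 else 1) + (if k < n then q ^ 2 else 0)

theorem abs_blockDiag_le {q : ℝ} (hq : 0 ≤ q) (hq1 : q ≤ 1) (n k : ℕ) : |blockDiag n q k| ≤ 2 := by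
  have h1 : q ^ 2 ≤ 1 := pow_le_one₀ hq hq1
  have h2 := sq_nonneg q
  unfold blockDiag
  rw [abs_le]
  split_ifs <;> constructor <;> linarith

theorem sum_blockDiag (n : ℕ) (q : ℝ) (F : ℕ → ℝ) :
    ∑ k ∈ Finset.range (n + 1), blockDiag n q k * F k =
      (1 - q ^ 2) * F 0 + ∑ k ∈ Finset.range n, (F (k + 1) + q ^ 2 * F k) := by
  have e : ∀ k ∈ Finset.range (n + 1), blockDiag n q k * F k =
      (if k = 0 then 1 - q ^ 2 else 1) * F k + (if k < n then q ^ 2 * F k else 0) := fun k _ => by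
    unfold blockDiag; split_ifs <;> ring
  rw [Finset.sum_congr rfl e, Finset.sum_add_distrib, Finset.sum_range_succ',
    Finset.sum_range_succ _ n, Finset.sum_add_distrib]
  have e2 : ∀ k ∈ Finset.range n, (if k < n then q ^ 2 * F k else 0) = q ^ 2 * F k := fun k hk => by
    rw [if_pos (Finset.mem_range.1 hk)]
  rw [Finset.sum_congr rfl e2]
  simp
  ring

theorem blockSq_eq (n : ℕ) (q A V : ℝ) (y : ℕ → ℝ) :
    blockSq n q A V y = ∑ k ∈ Finset.range (n + 1), blockDiag n q k * y k ^ 2 -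
      2 * q * ∑ k ∈ Finset.range n, y k * y (k + 1) - 2 * (1 - q ^ 2) * (A * y 0 - V * y n) +
      (1 - q ^ 2) * (A ^ 2 - 2 * q ^ n * A * V + V ^ 2) := by
  rw [sum_blockDiag n q fun k => y k ^ 2]
  induction n generalizing V with
  | zero => simp [blockSq]; ring
  | succ n ih =>
    rw [blockSq_succ, ih, Finset.sum_range_succ _ n, Finset.sum_range_succ _ n]
    ring

/-- The exact convexity defect of a sum of squares of affine forms is its homogeneous part; this
reduces strong concavity to a bound on that quadratic form. -/
theorem blockSq_affine (n : ℕ) (q A V : ℝ) {a b : ℝ} (hab : a + b = 1) (y z : ℕ → ℝ) :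
    blockSq n q A V (fun k => a * y k + b * z k) =
      a * blockSq n q A V y + b * blockSq n q A V z -
        a * b * blockSq n q 0 0 (fun k => y k - z k) := by
  obtain rfl : b = 1 - a := by linarith
  unfold blockSq
  simp only [mul_add, Finset.mul_sum, mul_zero, sub_zero, add_zero]
  have : ∀ S T U X Y Z V W : ℝ, W = X + Y - Z → V = S + T - U →
      V + W = S + X + (T + Y) - (U + Z) := by
    intros; linarith
  refine this _ _ _ _ _ _ _ _ ?_ (by ring)
  rw [← Finset.sum_add_distrib, ← Finset.sum_sub_distrib]
  exact Finset.sum_congr rfl fun k _ => by ring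

theorem blockSq_zero_ge {q : ℝ} (hq : 0 ≤ q) (hq1 : q ≤ 1) (n : ℕ) (y : ℕ → ℝ) :
    (1 - q) ^ 2 * ∑ k ∈ Finset.range (n + 1), y k ^ 2 ≤ blockSq n q 0 0 y := by
  -- The additional end term closes the induction: the step then leaves exactly q * (y (n + 1) - y
  -- n)².
  suffices h : (1 - q) ^ 2 * ∑ k ∈ Finset.range (n + 1), y k ^ 2 + q * (1 - q) * y n ^ 2 ≤
      blockSq n q 0 0 y by
    have : 0 ≤ q * (1 - q) * y n ^ 2 :=
      mul_nonneg (mul_nonneg hq (sub_nonneg.2 hq1)) (sq_nonneg _)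
    linarith
  induction n with
  | zero =>
    simp [blockSq]
    nlinarith [mul_nonneg (mul_nonneg hq (sub_nonneg.2 hq1)) (sq_nonneg (y 0))]
  | succ n ih =>
    rw [blockSq_succ, Finset.sum_range_succ, mul_zero, mul_zero, add_zero]
    nlinarith [mul_nonneg hq (sq_nonneg (y (n + 1) - y n))]

/-- The maximizing y superposes two geometric profiles, decaying from the two ends of the block; all
squares vanish at it simultaneously. -/
theorem blockSq_optimal (n : ℕ) (q A V : ℝ) :
    blockSq n q A V (fun k => A * q ^ k - V * q ^ (n - k)) = 0 := by
  unfold blockSq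
  rw [Finset.sum_eq_zero]
  · simp
    right; ring
  · intro k hk
    have hk := Finset.mem_range.1 hk
    beta_reduce
    rw [show n - k = n - 1 - k + 1 by omega, show n - (k + 1) = n - 1 - k by omega]
    ring

theorem sum_range_mul_eq (N B : ℕ) (F : ℕ → ℝ) :
    ∑ p ∈ Finset.range (N * B), F p =
      ∑ b ∈ Finset.range N, ∑ k ∈ Finset.range B, F (b * B + k) := by
  induction N with
  | zero => simp
  | succ N ih => rw [Nat.succ_mul, Finset.sum_range_add, ih, Finset.sum_range_succ]

/-- The terms of the coupled instance in single coordinates. -/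
noncomputable def blockNode (N n : ℕ) (lam σ r q ρ : ℝ) (p : ℕ) (x : ℝ) : ℝ :=
  if p % (n + 2) = 0 then nodeFun N lam σ r (lam * (1 - ρ)) (p / (n + 2)) x
  else -(lam / 2) * blockDiag n q (p % (n + 2) - 1) * x ^ 2

/-- The derivative of `blockNode`. -/
noncomputable def blockNode' (N n : ℕ) (lam σ r q ρ : ℝ) (p : ℕ) (x : ℝ) : ℝ :=
  if p % (n + 2) = 0 then nodeFun' N lam σ r (lam * (1 - ρ)) (p / (n + 2)) x
  else -lam * blockDiag n q (p % (n + 2) - 1) * x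

/-- The couplings of the coupled instance. -/
noncomputable def blockLink (N n : ℕ) (lam q α : ℝ) (p : ℕ) : ℝ :=
  if p % (n + 2) = 0 then (if 0 < p / (n + 2) ∧ p / (n + 2) < N then -α else 0)
  else if p % (n + 2) = 1 then (if p / (n + 2) + 1 < N then α else 0) else lam * q

theorem hasDerivAt_blockNode {σ : ℝ} (hσ : σ ≠ 0) (N n : ℕ) (lam r q ρ : ℝ) (p : ℕ) (x : ℝ) :
    HasDerivAt (blockNode N n lam σ r q ρ p) (blockNode' N n lam σ r q ρ p x) x := by
  by_cases hp : p % (n + 2) = 0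
  · unfold blockNode blockNode'
    simp only [hp, if_true]
    exact hasDerivAt_nodeFun hσ N lam r _ _ x
  · unfold blockNode blockNode'
    simp only [hp, if_false]
    exact ((hasDerivAt_pow 2 x).const_mul _).congr_deriv (by push_cast; ring)

theorem blockNode'_zero {N n : ℕ} {lam σ r q ρ : ℝ} {p : ℕ} (hp : 0 < p) :
    blockNode' N n lam σ r q ρ p 0 = 0 := by
  unfold blockNode'
  split_ifs with h
  · refine nodeFun'_zero (Nat.div_pos (Nat.le_of_dvd hp (Nat.dvd_of_mod_eq_zero h)) (by omega))
  · simp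

/-- The identity behind the construction: expanding the squares creates a product of adjacent nodes
with coefficient lam * ρ * q ^ n = lam, which cancels the coupling of Φ. The squares of the nodes
lower the node weight from lam to lam * (1 - ρ). -/
theorem chainFun_block_eq {N n : ℕ} {lam σ r q ρ β : ℝ} (hρ : (1 - q ^ 2) * β ^ 2 = ρ)
    (hρq : ρ * q ^ n = 1) (w : EuclideanSpace ℝ (Fin (N * (n + 2)))) (x : EuclideanSpace ℝ (Fin N))
    (hx : ∀ b < N, coordSeq w (b * (n + 2)) = coordSeq x b) :
    chainFun (N * (n + 2)) (blockNode N n lam σ r q ρ)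
        (blockLink N n lam q (lam * β * (1 - q ^ 2))) w =
      hardPrimal N lam σ r x - lam / 2 * ∑ b ∈ Finset.range N,
        blockSq n q (β * if b + 1 < N then coordSeq x b else 0)
          (β * if b + 1 < N then coordSeq x (b + 1) else 0)
          (fun k => coordSeq w (b * (n + 2) + k + 1)) := by
  set α := lam * β * (1 - q ^ 2) with hα
  -- The block after the last node has no successor; both its drives are 0, and it only keeps the
  -- block length uniform.
  set u : ℕ → ℝ := fun b => if b + 1 < N then coordSeq x b else 0 with hu
  set v : ℕ → ℝ := fun b => if b + 1 < N then coordSeq x (b + 1) else 0 with hv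
  set y : ℕ → ℕ → ℝ := fun b k => coordSeq w (b * (n + 2) + k + 1) with hy
  have hmod : ∀ b k, k < n + 2 → (b * (n + 2) + k) % (n + 2) = k := fun b k hk => by
    rw [Nat.mul_add_mod', Nat.mod_eq_of_lt hk]
  have hdiv : ∀ b k, k < n + 2 → (b * (n + 2) + k) / (n + 2) = b := fun b k hk => by
    rw [mul_comm, Nat.mul_add_div (by omega), Nat.div_eq_of_lt hk, add_zero]
  have hblock : ∀ b ∈ Finset.range N, ∑ k ∈ Finset.range (n + 2),
      (blockNode N n lam σ r q ρ (b * (n + 2) + k) (coordSeq w (b * (n + 2) + k)) +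
        blockLink N n lam q α (b * (n + 2) + k + 1) *
          (coordSeq w (b * (n + 2) + k) * coordSeq w (b * (n + 2) + k + 1))) =
      nodeFun N lam σ r (lam * (1 - ρ)) b (coordSeq x b) + α * (u b * y b 0 - v b * y b n) -
        lam / 2 * ∑ k ∈ Finset.range (n + 1), blockDiag n q k * y b k ^ 2 +
        lam * q * ∑ k ∈ Finset.range n, y b k * y b (k + 1) := by
    intro b hb
    have hb := Finset.mem_range.1 hb
    rw [Finset.sum_range_succ']
    have e0 : blockNode N n lam σ r q ρ (b * (n + 2) + 0) (coordSeq w (b * (n + 2) + 0)) =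
        nodeFun N lam σ r (lam * (1 - ρ)) b (coordSeq x b) := by
      unfold blockNode
      rw [hmod b 0 (by omega), hdiv b 0 (by omega), if_pos rfl, add_zero, hx b hb]
    have e1 : blockLink N n lam q α (b * (n + 2) + 0 + 1) *
          (coordSeq w (b * (n + 2) + 0) * coordSeq w (b * (n + 2) + 0 + 1)) =
        α * (u b * y b 0) := by
      unfold blockLink
      rw [add_zero, hmod b 1 (by omega), hdiv b 1 (by omega), if_neg one_ne_zero, if_pos rfl,
        hx b hb]
      simp only [hu, hy, add_zero]
      split_ifs <;> ring
    have e2 : ∀ k ∈ Finset.range (n + 1),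
        blockNode N n lam σ r q ρ (b * (n + 2) + (k + 1)) (coordSeq w (b * (n + 2) + (k + 1))) =
        -(lam / 2) * (blockDiag n q k * y b k ^ 2) := fun k hk => by
      have hk := Finset.mem_range.1 hk
      unfold blockNode
      rw [hmod b (k + 1) (by omega), if_neg (by omega), Nat.add_sub_cancel]
      simp only [hy, ← add_assoc]
      ring
    have e3 : ∀ k ∈ Finset.range n, blockLink N n lam q α (b * (n + 2) + (k + 1) + 1) *
        (coordSeq w (b * (n + 2) + (k + 1)) * coordSeq w (b * (n + 2) + (k + 1) + 1)) =
        lam * q * (y b k * y b (k + 1)) := fun k hk => by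
      have hk := Finset.mem_range.1 hk
      unfold blockLink
      rw [add_assoc _ (k + 1) 1, hmod b (k + 1 + 1) (by omega), if_neg (by omega),
        if_neg (by omega)]
      simp only [hy, ← add_assoc]
    have e4 : blockLink N n lam q α (b * (n + 2) + (n + 1) + 1) *
        (coordSeq w (b * (n + 2) + (n + 1)) * coordSeq w (b * (n + 2) + (n + 1) + 1)) =
        -α * (v b * y b n) := by
      unfold blockLink
      rw [show b * (n + 2) + (n + 1) + 1 = (b + 1) * (n + 2) + 0 by ring,
        hmod (b + 1) 0 (by omega), hdiv (b + 1) 0 (by omega), if_pos rfl]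
      simp only [hv, hy, Nat.succ_pos, true_and, ← add_assoc, add_zero]
      by_cases hbN : b + 1 < N
      · simp only [hbN, if_true]
        rw [hx _ hbN]
        ring
      · simp only [hbN, if_false]
        ring
    rw [Finset.sum_add_distrib, Finset.sum_congr rfl e2, Finset.sum_range_succ
      (fun k => blockLink N n lam q α (b * (n + 2) + (k + 1) + 1) *
        (coordSeq w (b * (n + 2) + (k + 1)) * coordSeq w (b * (n + 2) + (k + 1) + 1))) n,
      Finset.sum_congr rfl e3, e0, e1, e4, ← Finset.mul_sum, ← Finset.mul_sum]
    ring
  rw [chainFun, sum_range_mul_eq, Finset.sum_congr rfl hblock, hardPrimal, chainFun]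
  have hsq : ∀ b ∈ Finset.range N, nodeFun N lam σ r (lam * (1 - ρ)) b (coordSeq x b) +
        α * (u b * y b 0 - v b * y b n) -
        lam / 2 * ∑ k ∈ Finset.range (n + 1), blockDiag n q k * y b k ^ 2 +
        lam * q * ∑ k ∈ Finset.range n, y b k * y b (k + 1) =
      (nodeFun N lam σ r lam b (coordSeq x b) + primalLink N lam (b + 1) *
        (coordSeq x b * coordSeq x (b + 1))) - lam / 2 * blockSq n q (β * u b) (β * v b) (y b) -
      pathDeg N b * (lam * ρ / 2 * coordSeq x b ^ 2) +
        (if b + 1 < N then lam * ρ / 2 * coordSeq x b ^ 2 +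
          lam * ρ / 2 * coordSeq x (b + 1) ^ 2 else 0) := by
    intro b _
    rw [blockSq_eq]
    have e1 : nodeFun N lam σ r (lam * (1 - ρ)) b (coordSeq x b) =
        nodeFun N lam σ r lam b (coordSeq x b) -
          pathDeg N b * (lam * ρ / 2 * coordSeq x b ^ 2) := by
      unfold nodeFun; ring
    have e2 : (1 - q ^ 2) * ((β * u b) ^ 2 - 2 * q ^ n * (β * u b) * (β * v b) + (β * v b) ^ 2) =
        ρ * u b ^ 2 - 2 * (u b * v b) + ρ * v b ^ 2 := by
      rw [← hρ] at hρq ⊢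
      linear_combination (-2 * (u b * v b)) * hρq
    have e3 : primalLink N lam (b + 1) * (coordSeq x b * coordSeq x (b + 1)) =
        -lam * (u b * v b) := by
      simp only [primalLink, hu, hv, Nat.succ_pos, true_and]
      split_ifs <;> ring
    have e4 : (if b + 1 < N then lam * ρ / 2 * coordSeq x b ^ 2 +
          lam * ρ / 2 * coordSeq x (b + 1) ^ 2 else 0) = lam * ρ / 2 * (u b ^ 2 + v b ^ 2) := by
      simp only [hu, hv]
      split_ifs <;> ring
    rw [e1, e2, e3, e4, hα]
    ring
  rw [Finset.sum_congr rfl hsq, Finset.sum_add_distrib, Finset.sum_sub_distrib,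
    Finset.sum_sub_distrib, sum_pathDeg_mul N fun b => lam * ρ / 2 * coordSeq x b ^ 2,
    ← Finset.mul_sum]
  ring

theorem abs_blockNode'_sub_le {N n : ℕ} {lam σ r q ρ : ℝ} (hlam : 0 ≤ lam) (hσ : 0 < σ)
    (hr : 0 ≤ r) (hr1 : r ≤ 1) (hq : 0 ≤ q) (hq1 : q ≤ 1) (hρ : |1 - ρ| ≤ 1) (p : ℕ) (x y : ℝ) :
    |blockNode' N n lam σ r q ρ p x - blockNode' N n lam σ r q ρ p y| ≤ 9 * lam * |x - y| := by
  unfold blockNode'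
  split_ifs with h
  · refine abs_nodeFun'_sub_le hlam hσ hr hr1 ?_ _ x y
    rw [abs_mul, abs_of_nonneg hlam]
    nlinarith
  · rw [← mul_sub, abs_mul]
    refine mul_le_mul_of_nonneg_right ?_ (abs_nonneg _)
    rw [abs_mul, abs_neg, abs_of_nonneg hlam]
    nlinarith [abs_blockDiag_le hq hq1 n (p % (n + 2) - 1)]

theorem abs_blockLink_le {N n : ℕ} {lam q α : ℝ} (hlam : 0 ≤ lam) (hq : 0 ≤ q) (hq1 : q ≤ 1)
    (hα : |α| ≤ 2 * lam) (p : ℕ) : |blockLink N n lam q α p| ≤ 2 * lam := by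
  unfold blockLink
  split_ifs
  · rwa [abs_neg]
  · simpa using hlam
  · exact hα
  · simpa using hlam
  · rw [abs_mul, abs_of_nonneg hlam, abs_of_nonneg hq]
    nlinarith

/-- The instance for large condition number: neighbouring nodes are coupled through a block of
`n + 1` coordinates of the maximization variable. -/
theorem exists_coupled_instance {N n : ℕ} {lam σ r q μ : ℝ} (hlam : 0 < lam)
    (hσ : 0 < σ) (hr : 0 ≤ r) (hr1 : r ≤ 1) (hq : 0 < q) (hq1 : q < 1) (hqn : 1 / 2 ≤ q ^ n)
    (hμl : μ ≤ lam * (1 - q) ^ 2) :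
    ∃ f : JointSpace N (N * (n + 1)) → ℝ, IsSmoothWith (13 * lam) f ∧ IsStronglyConcaveInY μ f ∧
      IsPrimalFunction f (hardPrimal N lam σ r) ∧
      ∀ z : ℕ → JointSpace N (N * (n + 1)), IsFirstOrderSequence f z →
        ∀ t ≤ (N - 1) * (n + 2), coordSeq (z t).fst (N - 1) = 0 := by
  obtain ⟨e, he⟩ := exists_block_equiv N n
  have hq2 : 0 < 1 - q ^ 2 := by nlinarith
  set ρ : ℝ := 1 / q ^ n with hρ
  have hqn1 : q ^ n ≤ 1 := pow_le_one₀ hq.le hq1.le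
  have hρq : ρ * q ^ n = 1 := by rw [hρ]; field_simp
  have hρ1 : 1 ≤ ρ := by rw [hρ, le_div_iff₀ (by positivity)]; linarith
  have hρ2 : ρ ≤ 2 := by rw [hρ, div_le_iff₀ (by positivity)]; linarith
  -- This β makes the elimination of y produce the coefficient ρ on the squares of the nodes, while
  -- the coupling α stays bounded by 2 * lam even as q tends to 1.
  set β : ℝ := Real.sqrt (ρ / (1 - q ^ 2)) with hβ
  have hβρ : (1 - q ^ 2) * β ^ 2 = ρ := by
    rw [hβ, Real.sq_sqrt (by positivity)]; field_simp
  set α : ℝ := lam * β * (1 - q ^ 2) with hα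
  have hαle : |α| ≤ 2 * lam := by
    refine abs_le_of_sq_le_sq ?_ (by positivity)
    have e1 : α ^ 2 = lam ^ 2 * ((1 - q ^ 2) * ρ) := by rw [hα, ← hβρ]; ring
    have e2 : (1 - q ^ 2) * ρ ≤ 1 * 2 := by
      have := sq_nonneg q
      exact mul_le_mul (by linarith) hρ2 (by linarith) (by norm_num)
    rw [e1]
    nlinarith [mul_le_mul_of_nonneg_left e2 (sq_nonneg lam)]
  set h := blockNode N n lam σ r q ρ with hh
  set h' := blockNode' N n lam σ r q ρ with hh'
  set c := blockLink N n lam q α with hc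
  have hc0 : c 0 = 0 := by simp [hc, blockLink]
  have hder : ∀ p < N * (n + 2), ∀ x, HasDerivAt (h p) (h' p x) x := fun p _ =>
    hasDerivAt_blockNode hσ.ne' N n lam r q ρ p
  have hlt : ∀ b < N, ∀ k < n + 2, b * (n + 2) + k < N * (n + 2) := fun b hb k hk => by
    nlinarith [Nat.mul_le_mul_right (n + 2) (Nat.succ_le_of_lt hb)]
  have hW : ∀ (z : JointSpace N (N * (n + 1))), ∀ b < N,
      coordSeq (chainIso e z) (b * (n + 2)) = coordSeq z.fst b := by
    intro z b hb
    rw [← coordSeq_chainIso_inl e z hb, he]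
  set u : EuclideanSpace ℝ (Fin N) → ℕ → ℝ :=
    fun x b => β * if b + 1 < N then coordSeq x b else 0 with hu
  set v : EuclideanSpace ℝ (Fin N) → ℕ → ℝ :=
    fun x b => β * if b + 1 < N then coordSeq x (b + 1) else 0 with hv
  have hval : ∀ z : JointSpace N (N * (n + 1)), chainFun (N * (n + 2)) h c (chainIso e z) =
      hardPrimal N lam σ r z.fst - lam / 2 * ∑ b ∈ Finset.range N,
        blockSq n q (u z.fst b) (v z.fst b)
          (fun k => coordSeq (chainIso e z) (b * (n + 2) + k + 1)) := fun z =>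
    chainFun_block_eq hβρ hρq _ _ (hW z)
  refine ⟨chainFun (N * (n + 2)) h c ∘ chainIso e, IsSmoothWith.comp_isometry ?_ _, fun x => ?_,
    fun x => ⟨?_, ?_⟩, ?_⟩
  · refine isSmoothWith_chainFun (a := fun _ => 9 * lam) (by positivity) hder
      (fun p _ => abs_blockNode'_sub_le hlam.le hσ hr hr1 hq.le hq1.le
        (abs_le.2 ⟨by linarith, by linarith⟩) p) hc0 fun p _ => ?_
    have hcl := abs_blockLink_le (N := N) (n := n) hlam.le hq.le hq1.le hαle
    linarith [hcl p, hcl (p + 1)]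
  · refine ⟨convex_univ, fun y _ z _ a b ha hb hab => ?_⟩
    simp only [Function.comp_apply, hval, joint_fst, smul_eq_mul]
    have e1 : joint x (a • y + b • z) = a • joint x y + b • joint x z := by
      refine WithLp.ofLp_injective 2 (Prod.ext ?_ rfl)
      change x = a • x + b • x
      rw [← add_smul, hab, one_smul]
    have e2 : ∀ i ∈ Finset.range N, blockSq n q (u x i) (v x i)
        (fun k => coordSeq (chainIso e (joint x (a • y + b • z))) (i * (n + 2) + k + 1)) =
        a * blockSq n q (u x i) (v x i)
          (fun k => coordSeq (chainIso e (joint x y)) (i * (n + 2) + k + 1)) +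
        b * blockSq n q (u x i) (v x i)
          (fun k => coordSeq (chainIso e (joint x z)) (i * (n + 2) + k + 1)) -
        a * b * blockSq n q 0 0
          (fun k => coordSeq (chainIso e (joint 0 (y - z))) (i * (n + 2) + k + 1)) := by
      intro i _
      have e3 : joint 0 (y - z) = joint x y - joint x z := by
        refine WithLp.ofLp_injective 2 (Prod.ext ?_ rfl)
        change 0 = x - x
        rw [sub_self]
      simp only [e1, e3, map_add, map_smul, map_sub, coordSeq_add, coordSeq_smul, coordSeq_sub]
      exact blockSq_affine n q _ _ hab _ _
    have e4 : (1 - q) ^ 2 * ‖y - z‖ ^ 2 ≤ ∑ i ∈ Finset.range N, blockSq n q 0 0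
          (fun k => coordSeq (chainIso e (joint 0 (y - z))) (i * (n + 2) + k + 1)) := by
      have e5 : ‖y - z‖ ^ 2 = ‖joint (0 : EuclideanSpace ℝ (Fin N)) (y - z)‖ ^ 2 := by
        rw [WithLp.prod_norm_sq_eq_of_L2]
        simp
      rw [e5, ← (chainIso e).norm_map, norm_sq_eq_sum_coordSeq, sum_range_mul_eq, Finset.mul_sum]
      refine Finset.sum_le_sum fun i hi => ?_
      refine le_trans (le_of_eq ?_) (blockSq_zero_ge hq.le hq1.le n _)
      rw [Finset.sum_range_succ', add_zero, hW _ _ (Finset.mem_range.1 hi), joint_fst]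
      simp [coordSeq, add_assoc]
    rw [Finset.sum_congr rfl e2, Finset.sum_sub_distrib, Finset.sum_add_distrib, ← Finset.mul_sum,
      ← Finset.mul_sum, ← Finset.mul_sum]
    have e6 : μ / 2 * ‖y - z‖ ^ 2 ≤ lam / 2 * ((1 - q) ^ 2 * ‖y - z‖ ^ 2) := by
      nlinarith [sq_nonneg ‖y - z‖]
    have e7 := mul_le_mul_of_nonneg_left (e6.trans (mul_le_mul_of_nonneg_left e4
      (by positivity : 0 ≤ lam / 2))) (mul_nonneg ha hb)
    obtain rfl : b = 1 - a := by linarith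
    linarith
  -- The chain vector with the nodes of x in place and the optimal profile in every block; its
  -- y-part attains the maximum.
  · set G : ℕ → ℝ := fun p => if p % (n + 2) = 0 then coordSeq x (p / (n + 2))
      else u x (p / (n + 2)) * q ^ (p % (n + 2) - 1) -
        v x (p / (n + 2)) * q ^ (n - (p % (n + 2) - 1)) with hG
    have hmod : ∀ b k, k < n + 2 → (b * (n + 2) + k) % (n + 2) = k := fun b k hk => by
      rw [Nat.mul_add_mod', Nat.mod_eq_of_lt hk]
    have hdiv : ∀ b k, k < n + 2 → (b * (n + 2) + k) / (n + 2) = b := fun b k hk => by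
      rw [mul_comm, Nat.mul_add_div (by omega), Nat.div_eq_of_lt hk, add_zero]
    set z : JointSpace N (N * (n + 1)) :=
      (chainIso e).symm (WithLp.toLp 2 fun p : Fin (N * (n + 2)) => G p) with hz
    have hzG : ∀ p < N * (n + 2), coordSeq (chainIso e z) p = G p := fun p hp => by
      rw [hz, LinearIsometryEquiv.apply_symm_apply, coordSeq_toLp G hp]
    have hzx : z.fst = x := by
      ext i
      have h1 := hW z i i.2
      have h2 := hzG (i * (n + 2)) (hlt i i.2 0 (by omega))
      have h3 := hmod i 0 (by omega)
      have h4 := hdiv i 0 (by omega)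
      rw [add_zero] at h3 h4
      rw [← coordSeq_fin, ← coordSeq_fin, ← h1, h2]
      simp only [hG, h3, h4, if_true]
    refine ⟨z.snd, ?_⟩
    have hzj : joint x z.snd = z := by rw [← hzx]; rfl
    simp only [Function.comp_apply]
    rw [hzj, hval, hzx, Finset.sum_eq_zero, mul_zero, sub_zero]
    intro b hb
    have hb := Finset.mem_range.1 hb
    rw [← blockSq_optimal n q (u x b) (v x b)]
    have e1 : ∀ k ≤ n, coordSeq (chainIso e z) (b * (n + 2) + k + 1) =
        u x b * q ^ k - v x b * q ^ (n - k) := fun k hk => by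
      rw [add_assoc, hzG _ (hlt b hb (k + 1) (by omega))]
      simp only [hG]
      rw [hmod b (k + 1) (by omega), hdiv b (k + 1) (by omega), if_neg (by omega),
        Nat.add_sub_cancel]
    unfold blockSq
    beta_reduce
    rw [e1 0 (Nat.zero_le _)]
    congr 1
    refine Finset.sum_congr rfl fun k hk => ?_
    have hk := Finset.mem_range.1 hk
    rw [e1 k hk.le, e1 (k + 1) hk]
  · rintro _ ⟨y, rfl⟩
    simp only [Function.comp_apply, hval, joint_fst]
    have h1 : 0 ≤ ∑ b ∈ Finset.range N, blockSq n q (u x b) (v x b)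
          (fun k => coordSeq (chainIso e (joint x y)) (b * (n + 2) + k + 1)) :=
      Finset.sum_nonneg fun _ _ => blockSq_nonneg hq.le hq1.le _
    have : 0 ≤ lam / 2 * ∑ b ∈ Finset.range N, blockSq n q (u x b) (v x b)
          (fun k => coordSeq (chainIso e (joint x y)) (b * (n + 2) + k + 1)) := by positivity
    linarith
  · intro z hz t ht
    have h1 := coordSeq_eq_zero_of_isFirstOrderSequence e hder hc0
      (fun p hp _ => blockNode'_zero hp) hz t ((N - 1) * (n + 2)) ht
    rcases Nat.eq_zero_or_pos N with h0 | h0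
    · exact coordSeq_of_le _ (by omega)
    · rwa [hW _ _ (by omega)] at h1

/-! ### Choice of the block length. -/

/-- For lam < 4 * μ the condition number is below 52, so one step per node suffices and y may be
decoupled; otherwise blocks of length about √(lam / μ) / 2 are used. -/
theorem exists_hard_instance {N : ℕ} (hN : 1 ≤ N) {lam σ r μ : ℝ} (hlam : 0 < lam) (hσ : 0 < σ)
    (hr : 0 ≤ r) (hr1 : r ≤ 1) (hμ : 0 < μ) (hμl : μ ≤ 13 * lam) :
    ∃ (m B : ℕ) (f : JointSpace N m → ℝ), 0 < m ∧ Real.sqrt (13 * lam / μ) / 8 ≤ B ∧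
      IsSmoothWith (13 * lam) f ∧ IsStronglyConcaveInY μ f ∧
      IsPrimalFunction f (hardPrimal N lam σ r) ∧
      ∀ z : ℕ → JointSpace N m, IsFirstOrderSequence f z →
        ∀ t ≤ (N - 1) * B, coordSeq (z t).fst (N - 1) = 0 := by
  rcases lt_or_ge lam (4 * μ) with hc | hc
  · obtain ⟨f, h1, h2, h3, h4⟩ := exists_decoupled_instance (N := N) hlam hσ hr hr1 hμ hμl
    refine ⟨1, 1, f, one_pos, ?_, h1, h2, h3, by simpa using h4⟩
    have : Real.sqrt (13 * lam / μ) ≤ 8 := by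
      rw [Real.sqrt_le_left (by norm_num), div_le_iff₀ hμ]
      linarith
    rw [Nat.cast_one]
    linarith
  · set S := Real.sqrt (lam / μ) with hS
    have hS2 : S ^ 2 = lam / μ := Real.sq_sqrt (by positivity)
    have hS4 : 2 ≤ S := by
      rw [hS, Real.le_sqrt (by norm_num) (by positivity), le_div_iff₀ hμ]
      linarith
    obtain ⟨n, hn⟩ : ∃ n : ℕ, ⌊S / 2⌋₊ = n + 1 := Nat.exists_eq_succ_of_ne_zero
      (Nat.floor_pos.2 (by linarith)).ne'
    have hnS : ((n + 1 : ℕ) : ℝ) ≤ S / 2 := hn ▸ Nat.floor_le (by linarith)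
    have hnS' : S / 2 < ((n + 1 : ℕ) : ℝ) + 1 := hn ▸ Nat.lt_floor_add_one _
    push_cast at hnS hnS'
    -- By Bernoulli's inequality q ^ n ≥ 1 / 2, and (1 - q)² = 1 / (4 * (n + 1)²) is at least μ /
    -- lam because n + 1 ≤ S / 2.
    set q : ℝ := 1 - 1 / (2 * (n + 1)) with hq
    have hd : 1 / (2 * ((n : ℝ) + 1)) ≤ 1 / 2 := by
      apply one_div_le_one_div_of_le (by norm_num)
      have : (0 : ℝ) ≤ n := n.cast_nonneg
      linarith
    have hd0 : 0 < 1 / (2 * ((n : ℝ) + 1)) := by positivity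
    have hqn : 1 / 2 ≤ q ^ n := by
      have h1 := one_add_mul_le_pow (a := -(1 / (2 * ((n : ℝ) + 1)))) (by linarith) n
      have h2 : (n : ℝ) * -(1 / (2 * ((n : ℝ) + 1))) ≥ -(1 / 2) := by
        have e : (n : ℝ) * -(1 / (2 * ((n : ℝ) + 1))) = -(1 / 2) + 1 / (2 * ((n : ℝ) + 1)) := by
          field_simp
          ring
        linarith
      rw [← sub_eq_add_neg] at h1
      linarith
    have hμq : μ ≤ lam * (1 - q) ^ 2 := by
      have e : (1 - q) ^ 2 = 1 / (4 * ((n : ℝ) + 1) ^ 2) := by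
        rw [hq]
        field_simp
        ring
      rw [e, mul_one_div, le_div_iff₀ (by positivity)]
      have h1 : 4 * ((n : ℝ) + 1) ^ 2 ≤ S ^ 2 := by nlinarith
      rw [hS2, le_div_iff₀ hμ] at h1
      linarith
    obtain ⟨f, h1, h2, h3, h4⟩ := exists_coupled_instance (N := N) hlam hσ hr hr1
      (by linarith) (by linarith) hqn hμq
    refine ⟨N * (n + 1), n + 2, f, Nat.mul_pos hN n.succ_pos, ?_, h1, h2, h3, h4⟩
    have e : Real.sqrt (13 * lam / μ) ≤ 4 * S := by
      rw [Real.sqrt_le_left (by positivity), mul_pow, hS2]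
      have : 0 < lam / μ := by positivity
      rw [mul_div_assoc]
      linarith
    push_cast
    linarith

/-! ### Scaling and the final count. -/

theorem rpow_div_seven {x : ℝ} (hx : 0 < x) (k : ℕ) : (x ^ 7) ^ ((k : ℝ) / 7) = x ^ k := by
  rw [← Real.rpow_natCast x 7, ← Real.rpow_mul hx.le, ← Real.rpow_natCast]
  congr 1
  push_cast
  ring

/-- The scaling of the lower bound in terms of `θ`. -/
theorem rate_eq {lam P θ d : ℝ} (hlam : 0 < lam) (hP : 0 < P) (hθ : 0 < θ) (hd : 0 < d) :
    (13 * lam) ^ (3 / 7 : ℝ) * (9 * P) ^ (2 / 7 : ℝ) * (d * lam ^ 2 * θ ^ 7 / P) ^ (-12 / 7 : ℝ) =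
      (13 : ℝ) ^ (3 / 7 : ℝ) * 9 ^ (2 / 7 : ℝ) * d ^ (-12 / 7 : ℝ) *
        (P ^ 2 / (lam ^ 3 * θ ^ 12)) := by
  -- Passing to seventh roots turns all the exponents into natural numbers.
  obtain ⟨a, ha, rfl⟩ : ∃ a : ℝ, 0 < a ∧ lam = a ^ 7 :=
    ⟨lam ^ (1 / 7 : ℝ), by positivity, by
      rw [← Real.rpow_natCast, ← Real.rpow_mul hlam.le]; norm_num⟩
  obtain ⟨b, hb, rfl⟩ : ∃ b : ℝ, 0 < b ∧ P = b ^ 7 :=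
    ⟨P ^ (1 / 7 : ℝ), by positivity, by
      rw [← Real.rpow_natCast, ← Real.rpow_mul hP.le]; norm_num⟩
  have e1 : d * (a ^ 7) ^ 2 * θ ^ 7 / b ^ 7 = d * (a ^ 2 * θ / b) ^ 7 := by
    rw [div_pow, mul_pow]; ring
  have h3 := rpow_div_seven ha 3
  have h2 := rpow_div_seven hb 2
  have h12 := rpow_div_seven (show 0 < a ^ 2 * θ / b by positivity) 12
  push_cast at h3 h2 h12
  rw [e1, Real.mul_rpow (by norm_num) (by positivity), Real.mul_rpow (by norm_num) (by positivity),
    Real.mul_rpow hd.le (by positivity), neg_div, Real.rpow_neg (x := (a ^ 2 * θ / b) ^ 7)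
    (by positivity), h3, h2, h12]
  field_simp

/-- The consequence of the second bound on the accuracy. -/
theorem gap_condition {Δ lam P θ d : ℝ} (hΔ : 0 < Δ) (hlam : 0 < lam) (hP : 0 < P) (hθ : 0 < θ)
    (hd : 0 < d) (h : d * lam ^ 2 * θ ^ 7 / P ≤
      (1 / 4) * Δ ^ (7 / 10 : ℝ) * (lam * d ^ 2) ^ (-1 / 10 : ℝ) * (P * d ^ 3) ^ (2 / 5 : ℝ)) :
    4 * θ ^ 10 * lam ^ 3 ≤ Δ * P ^ 2 := by
  have h10 := pow_le_pow_left₀ (by positivity) h 10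
  have e1 : (Δ ^ (7 / 10 : ℝ)) ^ 10 = Δ ^ 7 := by
    rw [← Real.rpow_natCast, ← Real.rpow_mul hΔ.le, ← Real.rpow_natCast]; norm_num
  have e2 : ((lam * d ^ 2) ^ (-1 / 10 : ℝ)) ^ 10 = (lam * d ^ 2)⁻¹ := by
    rw [← Real.rpow_natCast, ← Real.rpow_mul (by positivity), ← Real.rpow_neg_one]; norm_num
  have e3 : ((P * d ^ 3) ^ (2 / 5 : ℝ)) ^ 10 = (P * d ^ 3) ^ 4 := by
    rw [← Real.rpow_natCast, ← Real.rpow_mul (by positivity), ← Real.rpow_natCast]; norm_num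
  rw [mul_pow, mul_pow, mul_pow, e1, e2, e3, div_pow, div_le_iff₀ (by positivity)] at h10
  have e4 : (1 / 4 : ℝ) ^ 10 * Δ ^ 7 * (lam * d ^ 2)⁻¹ * (P * d ^ 3) ^ 4 * P ^ 10 =
      d ^ 10 / lam * ((1 / 4) ^ 10 * (Δ * P ^ 2) ^ 7) := by
    field_simp
  have e5 : (d * lam ^ 2 * θ ^ 7) ^ 10 = d ^ 10 / lam * ((θ ^ 10 * lam ^ 3) ^ 7) := by
    field_simp
  rw [e4, e5] at h10
  have h11 := le_of_mul_le_mul_left h10 (by positivity)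
  refine le_of_pow_le_pow_left₀ (n := 7) (by norm_num) (by positivity) ?_
  have h12 : (4 * θ ^ 10 * lam ^ 3) ^ 7 = 4 ^ 7 * (θ ^ 10 * lam ^ 3) ^ 7 := by ring
  rw [h12]
  have h13 : 0 ≤ (Δ * P ^ 2) ^ 7 := by positivity
  nlinarith

theorem mainTheorem3 :
    ∃ l₁ l₂ c : ℝ, 0 < l₁ ∧ 0 < l₂ ∧ 0 < c ∧
      ∀ Δ ℓ L₂ μ ε : ℝ, 0 < Δ → 0 < ℓ → 0 < L₂ → 0 < μ → 0 < ε → 1 ≤ ℓ / μ →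
        ε ≤ min ((1 / 4) * (ℓ / l₁) ^ 2 * (L₂ / l₂)⁻¹)
          ((1 / 4) * Δ ^ (7 / 10 : ℝ) * (ℓ / l₁) ^ (-1 / 10 : ℝ) * (L₂ / l₂) ^ (2 / 5 : ℝ)) →
        ∃ (n m : ℕ) (f : JointSpace n m → ℝ) (Φ : EuclideanSpace ℝ (Fin n) → ℝ),
          0 < n ∧ 0 < m ∧
          IsSmoothWith ℓ f ∧
          IsStronglyConcaveInY μ f ∧
          IsPrimalFunction f Φ ∧
          HasLipschitzHessian L₂ Φ ∧
          (∃ xmin, (∀ x, Φ xmin ≤ Φ x) ∧ Φ 0 - Φ xmin ≤ Δ) ∧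
          ∀ z : ℕ → JointSpace n m, IsFirstOrderSequence f z →
            ∀ t : ℕ, ‖gradient Φ (z t).fst‖ ≤ ε →
              c * (Δ * Real.sqrt (ℓ / μ) * ℓ ^ (3 / 7 : ℝ) * L₂ ^ (2 / 7 : ℝ) *
                ε ^ (-12 / 7 : ℝ)) ≤ t := by
  obtain ⟨d, hd⟩ : ∃ d : ℝ, d = 1 / 10000 := ⟨_, rfl⟩
  have hd0 : 0 < d := by rw [hd]; norm_num
  set K : ℝ := (13 : ℝ) ^ (3 / 7 : ℝ) * 9 ^ (2 / 7 : ℝ) * d ^ (-12 / 7 : ℝ) with hK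
  have hK0 : 0 < K := by positivity
  -- The powers of d are balanced so that each of the two bounds on ε carries exactly one factor d,
  -- as ε = d * lam² * θ⁷ / P does. The 64 is 4 * 8 * 2, from N - 1 ≥ X / 4, the bound on B, and the
  -- 2 in X.
  refine ⟨13 / d ^ 2, 9 / d ^ 3, 1 / (64 * K), by positivity, by positivity, by positivity, ?_⟩
  intro Δ ℓ L₂ μ ε hΔ hℓ hL₂ hμ hε hκ hεle
  obtain ⟨lam, rfl⟩ : ∃ lam, ℓ = 13 * lam := ⟨ℓ / 13, by ring⟩
  obtain ⟨P, rfl⟩ : ∃ P, L₂ = 9 * P := ⟨L₂ / 9, by ring⟩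
  have hlam : 0 < lam := by linarith
  have hP : 0 < P := by linarith
  obtain ⟨hε1, hε2⟩ := le_min_iff.1 hεle
  rw [show 13 * lam / (13 / d ^ 2) = lam * d ^ 2 by field_simp,
    show 9 * P / (9 / d ^ 3) = P * d ^ 3 by field_simp] at hε1 hε2
  obtain ⟨θ, hθ, rfl⟩ : ∃ θ : ℝ, 0 < θ ∧ ε = d * lam ^ 2 * θ ^ 7 / P := by
    refine ⟨(ε * P / (d * lam ^ 2)) ^ (1 / 7 : ℝ), by positivity, ?_⟩
    rw [← Real.rpow_natCast _ 7, ← Real.rpow_mul (by positivity)]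
    norm_num
    field_simp
  have hθ1 : θ ≤ 1 := by
    have e : 1 / 4 * (lam * d ^ 2) ^ 2 * (P * d ^ 3)⁻¹ = d * lam ^ 2 * (1 / 4) / P := by
      field_simp
    rw [e, div_le_div_iff_of_pos_right hP] at hε1
    have h7 := le_of_mul_le_mul_left hε1 (by positivity)
    by_contra! hcon
    have := one_lt_pow₀ hcon (n := 7) (by norm_num)
    linarith
  have hgap := gap_condition hΔ hlam hP hθ hd0 hε2
  -- Chosen so that lam * r² / σ = P with r = θ²; then ε = d * lam * σ * θ³ is exactly the lower
  -- bound on the gradient.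
  set σ : ℝ := lam * θ ^ 4 / P with hσdef
  have hσ : 0 < σ := by positivity
  set D : ℝ := Δ / (lam * σ ^ 2) with hD
  have hDσ : lam * σ ^ 2 * D = Δ := by rw [hD]; field_simp
  have hD4 : 4 * θ ^ 2 ≤ D := by
    rw [hD, le_div_iff₀ (by positivity), hσdef, div_pow, ← mul_div_assoc, ← mul_div_assoc,
      div_le_iff₀ (by positivity)]
    calc _ = 4 * θ ^ 10 * lam ^ 3 := by ring
      _ ≤ _ := hgap
  -- Half of the normalized gap D is allotted to the N potentials of size θ⁴; the boundary energy θ²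
  -- / 2 is at most D / 8.
  set X : ℝ := D / (2 * θ ^ 4) with hX
  have hX2 : 2 ≤ X := by
    rw [hX, le_div_iff₀ (by positivity)]
    have : θ ^ 4 ≤ θ ^ 2 := pow_le_pow_of_le_one hθ.le hθ1 (by norm_num)
    linarith
  set N := ⌊X⌋₊ with hN
  have hN2 : 2 ≤ N := Nat.le_floor (by exact_mod_cast hX2)
  have hNX : (N : ℝ) ≤ X := Nat.floor_le (by linarith)
  have hNX' : X < N + 1 := Nat.lt_floor_add_one X
  have hN1 : X / 4 ≤ ((N - 1 : ℕ) : ℝ) := by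
    rw [Nat.cast_sub (by omega), Nat.cast_one]
    have : (2 : ℝ) ≤ N := by exact_mod_cast hN2
    linarith
  obtain ⟨m, B, f, hm, hB, hf1, hf2, hf3, hf4⟩ := exists_hard_instance (N := N) (by omega) hlam hσ
    (sq_nonneg θ) (pow_le_one₀ hθ.le hθ1) hμ (by rwa [one_le_div hμ] at hκ)
  refine ⟨N, m, f, hardPrimal N lam σ (θ ^ 2), by omega, hm, hf1, hf2, hf3, ?_, ?_, ?_⟩
  · have h := hasLipschitzHessian_hardPrimal N hlam.le hσ (θ ^ 2)
    rwa [show lam * (θ ^ 2) ^ 2 / σ = P by rw [hσdef]; field_simp] at h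
  · obtain ⟨xmin, h1, h2⟩ := exists_min_hardPrimal N hlam.le hσ (sq_nonneg θ)
    refine ⟨xmin, h1, h2.trans ?_⟩
    rw [← hDσ]
    refine mul_le_mul_of_nonneg_left ?_ (by positivity)
    have h3 : (N : ℝ) * (2 * θ ^ 4) ≤ D := by
      rw [← le_div_iff₀ (by positivity)]; exact hNX
    have h4 : ((θ : ℝ) ^ 2) ^ 2 = θ ^ 4 := by ring
    rw [h4]
    linarith [sq_nonneg θ]
  · intro z hz t ht
    have hlt : (N - 1) * B < t := by
      by_contra! hcon
      have h1 := lt_norm_gradient_hardPrimal (by omega) hlam hσ hθ hθ1 (hf4 z hz t hcon)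
      refine absurd ht (not_le.2 (lt_of_le_of_lt (le_of_eq ?_) h1))
      rw [hσdef, hd]
      field_simp
    have hlt' : ((N - 1 : ℕ) : ℝ) * B ≤ t := by exact_mod_cast hlt.le
    refine le_trans ?_ hlt'
    have h1 : X / 4 * (Real.sqrt (13 * lam / μ) / 8) ≤ ((N - 1 : ℕ) : ℝ) * B :=
      mul_le_mul hN1 hB (by positivity) (by positivity)
    refine le_trans (le_of_eq ?_) h1
    have h2 := rate_eq hlam hP hθ hd0
    rw [← hK] at h2
    calc _ = 1 / (64 * K) * (Δ * Real.sqrt (13 * lam / μ) * ((13 * lam) ^ (3 / 7 : ℝ) *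
          (9 * P) ^ (2 / 7 : ℝ) * (d * lam ^ 2 * θ ^ 7 / P) ^ (-12 / 7 : ℝ))) := by ring
      _ = _ := by
        rw [h2, hX, hD, hσdef]
        field_simp
        norm_num
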